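/- Let $\mu$ be a nonzero real constant and consider the viscous transonic equation $$v_{yy}=2v_{xt}+v_xv_{xx}-v_{zz}-\mu v_{xxx}$$ in the independent variables $x,y,z,t$. Let $\mathcal F_{\mathcal E}$ be the algebra of smooth real functions of $x,y,z,t$ and of the derivatives $v_I=\partial_x^{i_1}\partial_z^{i_2}\partial_t^{i_3}v$ and $w_I=\partial_x^{i_1}\partial_z^{i_2}\partial_t^{i_3}v_y$, $I=(i_1,i_2,i_3)\in\mathbb Z_+^3$, each function depending on finitely many of these variables. Let $\bar D_x,\bar D_y,\bar D_z,\bar D_t$ be the total derivatives on $\mathcal F_{\mathcal E}$, where in $\bar D_y$ the derivative $v_{yy}$ and its derivatives are expressed through the equation: with $F=2v_{xt}+v_xv_{xx}-v_{zz}-\mu v_{xxx}$ and $\bar D^I=\bar D_x^{i_1}\bar D_z^{i_2}\bar D_t^{i_3}$, $$\bar D_y=\frac{\partial}{\partial y}+\sum_I w_I\frac{\partial}{\partial v_I}+\sum_I \bar D^I(F)\frac{\partial}{\partial w_I}.$$ A conserved current is a tuple $J=(J_y,J_x,J_z,J_t)$ of elements of $\mathcal F_{\mathcal E}$ with $\bar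 D_yJ_y+\bar D_xJ_x+\bar D_zJ_z+\bar D_tJ_t=0$. Numbering the independent variables as $y,x,z,t$, a current is trivial if $J_k=\sum_{l<k}\bar D_l(\mathcal L_{lk})-\sum_{k<l}\bar D_l(\mathcal L_{kl})$ for some $\mathcal L_{kl}\in\mathcal F_{\mathcal E}$, $k<l$; two currents are equivalent if they differ by a trivial one. The characteristic of $J$ is $\sum_I(-1)^{|I|}\bar D^I\bigl(\partial J_y/\partial w_I\bigr)$. 1. For every conserved current $J$, its characteristic is a smooth function $\chi=\chi(x,y,z,t)$ of the independent variables only, it satisfies $\chi_x=0$ and $\chi_{yy}+\chi_{zz}=0$, and $J$ is equivalent to the current $$J_y=\chi v_y-\chi_yv,\quad J_x=\mu\chi v_{xx}-\tfrac12\chi v_x^2-2\chi v_t,\quad J_z=\chi v_z-\chi_zv,\quad J_t=0.\qquad(*)$$ 2. Conversely, for every smooth function $\chi(x,y,z,t)$ with $\chi_x=0$ and $\chi_{yy}+\chi_{zz}=0$, the tuple $(*)$ is a conserved current and its characteristic is $\chi$. -/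

import Mathlib

namespace ViscousTransonic

/-- Partial derivative of a function of the variables `p c`, `c : ι`, with respect to the
variable number `c`. -/
noncomputable def pd {ι : Type} [DecidableEq ι] (c : ι) (f : (ι → ℝ) → ℝ) (p : ι → ℝ) : ℝ :=
  deriv (fun s : ℝ => f (Function.update p c s)) (p c)

/-- Internal coordinates on the infinitely prolonged equation
`v_yy = 2 v_xt + v_x v_xx - v_zz - μ v_xxx`, solved for `v_yy`.

* `Sum.inl i` is the independent variable number `i`, in the order `0 = y`, `1 = x`, `2 = z`,
  `3 = t`;
* `Sum.inr (s, I)`, with `s ∈ {0, 1}`, is the derivative of `v` of order `s` in `y` and of orders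
  `I 0`, `I 1`, `I 2` in `x`, `z`, `t`. -/
abbrev Coord : Type := Fin 4 ⊕ (Fin 2 × (Fin 3 → ℕ))

/-- A point: a value for each coordinate. -/
abbrev Pt : Type := Coord → ℝ

/-- Membership in the algebra of smooth functions of the internal coordinates: each function
depends smoothly on finitely many coordinates and on no others. -/
def IsSmooth (f : Pt → ℝ) : Prop :=
  ∃ (S : Finset Coord) (g : (S → ℝ) → ℝ),
    ContDiff ℝ (⊤ : ℕ∞) g ∧ ∀ p : Pt, f p = g (fun c => p c)

/-- The function `∂_y^s ∂_x^a ∂_z^b ∂_t^c v`, for `s ∈ {0, 1}`. -/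
def jet (s : Fin 2) (a b c : ℕ) (p : Pt) : ℝ := p (Sum.inr (s, ![a, b, c]))

/-- The total derivative in the variable `x`, `z`, `t` for `i = 0`, `1`, `2` respectively. The sum
has finitely many nonzero terms when `f` is smooth. -/
noncomputable def spaceD (i : Fin 3) (f : Pt → ℝ) (p : Pt) : ℝ :=
  pd (Sum.inl i.succ) f p +
    ∑ᶠ c : Fin 2 × (Fin 3 → ℕ), p (Sum.inr (c.1, c.2 + Pi.single i 1)) * pd (Sum.inr c) f p

/-- The iterated total derivative `D_x^(I 0) D_z^(I 1) D_t^(I 2)`. -/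
noncomputable def spaceDIter (I : Fin 3 → ℕ) (f : Pt → ℝ) : Pt → ℝ :=
  (spaceD 0)^[I 0] ((spaceD 1)^[I 1] ((spaceD 2)^[I 2] f))

/-- The right-hand side `2 v_xt + v_x v_xx - v_zz - μ v_xxx`. -/
def rhs (μ : ℝ) (p : Pt) : ℝ :=
  2 * jet 0 1 0 1 p + jet 0 1 0 0 p * jet 0 2 0 0 p - jet 0 0 2 0 p - μ * jet 0 3 0 0 p

/-- The total derivative in `y`, restricted to the equation: `v_yy` and its derivatives are replaced
by the right-hand side and its total derivatives. -/
noncomputable def evolD (μ : ℝ) (f : Pt → ℝ) (p : Pt) : ℝ :=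
  pd (Sum.inl 0) f p +
    (∑ᶠ I : Fin 3 → ℕ, p (Sum.inr (1, I)) * pd (Sum.inr (0, I)) f p) +
    ∑ᶠ I : Fin 3 → ℕ, spaceDIter I (rhs μ) p * pd (Sum.inr (1, I)) f p

/-- The total derivatives on the equation, in the order `y`, `x`, `z`, `t`. -/
noncomputable def totalD (μ : ℝ) (i : Fin 4) : (Pt → ℝ) → (Pt → ℝ) :=
  Fin.cases (evolD μ) spaceD i

/-- `J = (J_y, J_x, J_z, J_t)` is a conserved current. -/
def IsConservedCurrent (μ : ℝ) (J : Fin 4 → Pt → ℝ) : Prop :=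
  (∀ i, IsSmooth (J i)) ∧ ∀ p : Pt, ∑ i, totalD μ i (J i) p = 0

/-- `J` is trivial: `J_k = ∑_{l < k} D_l (L_lk) - ∑_{k < l} D_l (L_kl)` for some smooth `L_kl`,
`k < l`. -/
def IsTrivialCurrent (μ : ℝ) (J : Fin 4 → Pt → ℝ) : Prop :=
  ∃ L : Fin 4 → Fin 4 → Pt → ℝ, (∀ k l, k < l → IsSmooth (L k l)) ∧
    ∀ (k : Fin 4) (p : Pt), J k p =
      (∑ l ∈ Finset.univ.filter (fun l => l < k), totalD μ l (L l k) p) -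
        ∑ l ∈ Finset.univ.filter (fun l => k < l), totalD μ l (L k l) p

/-- Two currents are equivalent when they differ by a trivial one. -/
def CurrentEquiv (μ : ℝ) (J J' : Fin 4 → Pt → ℝ) : Prop :=
  IsTrivialCurrent μ (J - J')

/-- The characteristic of a conserved current,
`∑_I (-1)^|I| D^I (∂J_y / ∂(∂^I v_y))`, where `D^I` are the total derivatives in `x`, `z`, `t`. -/
noncomputable def characteristic (J : Fin 4 → Pt → ℝ) (p : Pt) : ℝ :=
  ∑ᶠ I : Fin 3 → ℕ, (-1) ^ (∑ i, I i) * spaceDIter I (pd (Sum.inr (1, I)) (J 0)) p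

/-- A function of the independent variables, regarded as a function of all coordinates. -/
def lift (χ : (Fin 4 → ℝ) → ℝ) (p : Pt) : ℝ := χ (fun i => p (Sum.inl i))

/-- `χ` is a smooth function of `(y, x, z, t)` with `χ_x = 0` and `χ_yy + χ_zz = 0`. -/
def IsAdmissible (χ : (Fin 4 → ℝ) → ℝ) : Prop :=
  ContDiff ℝ (⊤ : ℕ∞) χ ∧ (∀ q, pd 1 χ q = 0) ∧ ∀ q, pd 0 (pd 0 χ) q + pd 2 (pd 2 χ) q = 0

/-- The current with components
`J_y = χ v_y - χ_y v`, `J_x = μ χ v_xx - (1/2) χ v_x² - 2 χ v_t`, `J_z = χ v_z - χ_z v`,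
`J_t = 0`. -/
noncomputable def explicitCurrent (μ : ℝ) (χ : (Fin 4 → ℝ) → ℝ) : Fin 4 → Pt → ℝ :=
  ![fun p => lift χ p * jet 1 0 0 0 p - lift (pd 0 χ) p * jet 0 0 0 0 p,
    fun p => μ * lift χ p * jet 0 2 0 0 p - 1 / 2 * lift χ p * jet 0 1 0 0 p ^ 2
      - 2 * lift χ p * jet 0 0 0 1 p,
    fun p => lift χ p * jet 0 0 1 0 p - lift (pd 2 χ) p * jet 0 0 0 0 p,
    fun _ => 0]

end ViscousTransonic

/-!
Applying the Euler operators in `v` and `v_y` to `D_y J_y + D_x J_x + D_z J_z + D_t J_t = 0` shows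
that the characteristic `ψ` of a conserved current solves the adjoint of the linearized equation,
`D_y² ψ = 2 D_x D_t ψ + v_x D_x² ψ + v_xx D_x ψ - D_z² ψ + μ D_x³ ψ`, and that `E_v(J_y) = -D_y ψ`.

Count the weight of a jet coordinate as `2` for every derivative in `x`, `z`, `t` and `3` for the
one in `y`. If `Θ` is the leading part of the vertical differential of `ψ`, the leading parts of the
two sides of this equation are `-μ Θ` and `μ Θ`, both shifted by three derivatives in `x`; as
`μ ≠ 0`, the function `ψ` depends on the independent variables only. The coefficient of `v_xx` then
gives `ψ_x = 0`, and what remains is `ψ_yy + ψ_zz = 0`.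

The explicit current has the same characteristic `ψ`, so it remains to see that a conserved current
with zero characteristic is trivial. Both Euler operators annihilate `J_y`, hence `J_y` is a
divergence in `x`, `z`, `t`; subtracting a trivial current, we may assume `J_y = 0`, and
`(J_x, J_z, J_t)` is then a curl. Both exactness statements are proved for vertical forms, where
they are algebraic, and carried over to functions by integration along the fibres `p ↦ s p`.
-/

namespace ViscousTransonic

open scoped ContDiff Function

/-! ### Integrals depending on a parameter -/

section ParametricIntegral

universe u

variable {E F : Type u} [NormedAddCommGroup E] [NormedSpace ℝ E] [LocallyCompactSpace E]
  [NormedAddCommGroup F] [NormedSpace ℝ F] {f : E → ℝ → F}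

theorem hasFDerivAt_intervalIntegral_of_contDiff (hf : ContDiff ℝ 1 ↿f) (a b : ℝ) (x : E) :
    HasFDerivAt (fun x => ∫ s in a..b, f x s)
      (∫ s in a..b, (fderiv ℝ ↿f (x, s)).comp (ContinuousLinearMap.inl ℝ E ℝ)) x := by
  have hf' : Continuous fun q : E × ℝ => (fderiv ℝ ↿f q).comp (ContinuousLinearMap.inl ℝ E ℝ) :=
    (hf.continuous_fderiv one_ne_zero).clm_comp continuous_const
  have hpair (y : E) : Continuous fun s : ℝ => (y, s) := by fun_prop
  obtain ⟨K, hK, hKx⟩ := exists_compact_mem_nhds x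
  obtain ⟨C, hC⟩ := (hK.prod (isCompact_uIcc (a := a) (b := b))).exists_bound_of_continuousOn
    hf'.continuousOn
  refine intervalIntegral.hasFDerivAt_integral_of_dominated_of_fderiv_le (F := f)
    (F' := fun y s => (fderiv ℝ ↿f (y, s)).comp (ContinuousLinearMap.inl ℝ E ℝ))
    (bound := fun _ => C) hKx
    (.of_forall fun y => (hf.continuous.comp (hpair y)).aestronglyMeasurable)
    ((hf.continuous.comp (hpair x)).intervalIntegrable a b)
    (hf'.comp (hpair x)).aestronglyMeasurable
    (.of_forall fun s hs y hy => hC (y, s) ⟨hy, Set.uIoc_subset_uIcc hs⟩)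
    intervalIntegrable_const (.of_forall fun s _ y _ => ?_)
  have hfy : HasFDerivAt ↿f (fderiv ℝ ↿f (y, s)) (y, s) :=
    (hf.differentiable one_ne_zero (y, s)).hasFDerivAt
  exact hfy.comp (f := fun e => (e, s)) y (hasFDerivAt_prodMk_left y s)

theorem contDiff_intervalIntegral {n : ℕ∞} (hf : ContDiff ℝ n ↿f) (a b : ℝ) :
    ContDiff ℝ n fun x => ∫ s in a..b, f x s := by
  suffices ∀ (m : ℕ) {F : Type u} [NormedAddCommGroup F] [NormedSpace ℝ F] {f : E → ℝ → F},
      ContDiff ℝ m ↿f → ContDiff ℝ m fun x => ∫ s in a..b, f x s from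
    contDiff_iff_forall_nat_le.2 fun m hm => this m (hf.of_le (by exact_mod_cast hm))
  intro m
  induction m with
  | zero =>
    intro F _ _ f hf
    exact contDiff_zero.2
      (intervalIntegral.continuous_parametric_intervalIntegral_of_continuous' hf.continuous a b)
  | succ m ih =>
    intro F _ _ f hf
    have hderiv := hasFDerivAt_intervalIntegral_of_contDiff (hf.of_le (by simp)) a b
    rw [Nat.cast_succ] at hf
    rw [Nat.cast_succ, contDiff_succ_iff_fderiv]
    refine ⟨fun x => (hderiv x).differentiableAt, by simp, ?_⟩
    rw [funext fun x => (hderiv x).fderiv]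
    exact ih ((hf.fderiv_right le_rfl).clm_comp contDiff_const)

end ParametricIntegral

theorem hasDerivAt_intervalIntegral_of_contDiff {F : Type} [NormedAddCommGroup F] [NormedSpace ℝ F]
    {f : ℝ → ℝ → F} (hf : ContDiff ℝ 1 ↿f) {f' : ℝ → F} {x : ℝ}
    (h : ∀ s, HasDerivAt (f · s) (f' s) x) (a b : ℝ) :
    HasDerivAt (fun x => ∫ s in a..b, f x s) (∫ s in a..b, f' s) x := by
  have hcont : Continuous fun s : ℝ =>
      (fderiv ℝ ↿f (x, s)).comp (ContinuousLinearMap.inl ℝ ℝ ℝ) :=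
    ((hf.continuous_fderiv one_ne_zero).comp (by fun_prop)).clm_comp continuous_const
  have hint := (hasFDerivAt_intervalIntegral_of_contDiff hf a b x).hasDerivAt
  rw [ContinuousLinearMap.intervalIntegral_apply (hcont.intervalIntegrable a b)] at hint
  refine hint.congr_deriv (intervalIntegral.integral_congr fun s _ => HasDerivAt.unique ?_ (h s))
  have hfx : HasFDerivAt ↿f (fderiv ℝ ↿f (x, s)) (x, s) :=
    (hf.differentiable one_ne_zero (x, s)).hasFDerivAt
  exact (hfx.comp x (hasFDerivAt_prodMk_left x s)).hasDerivAt

/-! ### Smooth cylinder functions -/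

/-- Smooth cylinder functions: smooth functions of finitely many of the coordinates of `ι → ℝ`.
`IsSmooth` is the case `ι = Coord`. -/
def IsSmoothCyl {ι : Type} (f : (ι → ℝ) → ℝ) : Prop :=
  ∃ (S : Finset ι) (g : (S → ℝ) → ℝ), ContDiff ℝ ∞ g ∧ ∀ p, f p = g fun c => p c

namespace IsSmoothCyl

variable {ι : Type} {f f' : (ι → ℝ) → ℝ}

theorem const (r : ℝ) : IsSmoothCyl fun _ : ι → ℝ => r :=
  ⟨∅, fun _ => r, contDiff_const, fun _ => rfl⟩

theorem eval (c : ι) : IsSmoothCyl fun p : ι → ℝ => p c :=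
  ⟨{c}, fun q => q ⟨c, Finset.mem_singleton_self c⟩, by fun_prop, fun _ => rfl⟩

theorem comp₂ {φ : ℝ × ℝ → ℝ} (hφ : ContDiff ℝ ∞ φ) (hf : IsSmoothCyl f)
    (hf' : IsSmoothCyl f') : IsSmoothCyl fun p => φ (f p, f' p) := by
  classical
  obtain ⟨S, g, hg, hfg⟩ := hf
  obtain ⟨S', g', hg', hfg'⟩ := hf'
  refine ⟨S ∪ S', fun q => φ (g fun c => q ⟨c, Finset.mem_union_left S' c.2⟩,
    g' fun c => q ⟨c, Finset.mem_union_right S c.2⟩), ?_, fun p => by simp only [hfg, hfg']⟩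
  exact hφ.comp ((hg.comp (by fun_prop)).prodMk (hg'.comp (by fun_prop)))

theorem add (hf : IsSmoothCyl f) (hf' : IsSmoothCyl f') : IsSmoothCyl (f + f') :=
  comp₂ contDiff_add hf hf'

theorem mul (hf : IsSmoothCyl f) (hf' : IsSmoothCyl f') : IsSmoothCyl (f * f') :=
  comp₂ contDiff_mul hf hf'

theorem contDiff_comp {E : Type*} [NormedAddCommGroup E] [NormedSpace ℝ E] {γ : E → ι → ℝ}
    {n : ℕ∞} (hf : IsSmoothCyl f) (hγ : ∀ c, ContDiff ℝ n (γ · c)) :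
    ContDiff ℝ n fun x => f (γ x) := by
  obtain ⟨S, g, hg, hfg⟩ := hf
  simp only [hfg]
  exact (hg.of_le (by exact_mod_cast le_top)).comp (contDiff_pi.2 fun c => hγ c)

end IsSmoothCyl

/-- The smooth cylinder functions as a subalgebra of the algebra of all functions. -/
def smoothCylSubalgebra (ι : Type) : Subalgebra ℝ ((ι → ℝ) → ℝ) where
  carrier := {f | IsSmoothCyl f}
  mul_mem' := IsSmoothCyl.mul
  add_mem' := IsSmoothCyl.add
  algebraMap_mem' := IsSmoothCyl.const

/-- The algebra of smooth cylinder functions; for `ι = Coord` this is `𝓕_𝓔`. It is a type of its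
own, and not the coercion of `smoothCylSubalgebra ι`, to keep instance search short. -/
def SmoothCyl (ι : Type) : Type := smoothCylSubalgebra ι

namespace SmoothCyl

variable {ι : Type}

noncomputable instance : CommRing (SmoothCyl ι) :=
  inferInstanceAs (CommRing (smoothCylSubalgebra ι))

noncomputable instance : Algebra ℝ (SmoothCyl ι) :=
  inferInstanceAs (Algebra ℝ (smoothCylSubalgebra ι))

instance : FunLike (SmoothCyl ι) (ι → ℝ) ℝ where
  coe f := (show smoothCylSubalgebra ι from f).1
  coe_injective _ _ h := Subtype.ext h

/-- A smooth cylinder function as an element of `SmoothCyl ι`. -/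
def mk (f : (ι → ℝ) → ℝ) (h : IsSmoothCyl f) : SmoothCyl ι := (⟨f, h⟩ : smoothCylSubalgebra ι)

theorem isSmoothCyl (f : SmoothCyl ι) : IsSmoothCyl f := (show smoothCylSubalgebra ι from f).2

@[ext] theorem ext {f g : SmoothCyl ι} (h : ∀ p, f p = g p) : f = g := DFunLike.ext f g h

@[simp] theorem mk_apply (f : (ι → ℝ) → ℝ) (h : IsSmoothCyl f) (p : ι → ℝ) : mk f h p = f p := rfl
@[simp] theorem zero_apply (p : ι → ℝ) : (0 : SmoothCyl ι) p = 0 := rfl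
@[simp] theorem add_apply (f g : SmoothCyl ι) (p : ι → ℝ) : (f + g) p = f p + g p := rfl
@[simp] theorem sub_apply (f g : SmoothCyl ι) (p : ι → ℝ) : (f - g) p = f p - g p := rfl
@[simp] theorem neg_apply (f : SmoothCyl ι) (p : ι → ℝ) : (-f) p = -f p := rfl
@[simp] theorem mul_apply (f g : SmoothCyl ι) (p : ι → ℝ) : (f * g) p = f p * g p := rfl
@[simp] theorem smul_apply (r : ℝ) (f : SmoothCyl ι) (p : ι → ℝ) : (r • f) p = r * f p := rfl

@[simp] theorem sum_apply {α : Type*} (s : Finset α) (f : α → SmoothCyl ι) (p : ι → ℝ) :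
    (∑ i ∈ s, f i) p = ∑ i ∈ s, f i p :=
  map_sum (⟨⟨(· p), zero_apply p⟩, fun f g => add_apply f g p⟩ : SmoothCyl ι →+ ℝ) f s

/-- A coordinate function. -/
def coord (c : ι) : SmoothCyl ι := mk (fun p => p c) (.eval c)

@[simp] theorem coord_apply (c : ι) (p : ι → ℝ) : coord c p = p c := rfl

end SmoothCyl

open SmoothCyl

/-! ### Partial derivatives -/

section PartialDerivative

variable {ι : Type}

theorem hasDerivAt_comp_of_eq_restrict {S : Finset ι} {g : (S → ℝ) → ℝ}
    {f : (ι → ℝ) → ℝ} (hg : ContDiff ℝ ∞ g) (hf : ∀ p, f p = g fun c => p c)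
    {γ : ℝ → ι → ℝ} {γ' : ι → ℝ} {s : ℝ} (hγ : ∀ c, HasDerivAt (γ · c) (γ' c) s) :
    HasDerivAt (fun r => f (γ r)) (fderiv ℝ g (fun c => γ s c) (fun c => γ' c)) s := by
  simp only [hf]
  exact (hg.differentiable (by simp) fun c => γ s c).hasFDerivAt.comp_hasDerivAt s
    (hasDerivAt_pi.2 fun c : S => hγ c)

variable [DecidableEq ι]

theorem hasDerivAt_update_apply (p : ι → ℝ) (c d : ι) (s : ℝ) :
    HasDerivAt (fun r => Function.update p c r d) ((Pi.single c 1 : ι → ℝ) d) s :=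
  hasDerivAt_pi.1 (hasDerivAt_update p c s) d

section Representation

variable {S : Finset ι} {g : (S → ℝ) → ℝ} {f : (ι → ℝ) → ℝ}

theorem pd_eq_fderiv_restrict (hg : ContDiff ℝ ∞ g) (hf : ∀ p, f p = g fun c => p c) (c : ι)
    (p : ι → ℝ) : pd c f p = fderiv ℝ g (fun d => p d) (fun d => (Pi.single c 1 : ι → ℝ) d) := by
  have := (hasDerivAt_comp_of_eq_restrict hg hf (hasDerivAt_update_apply p c · (p c))).deriv
  rwa [Function.update_eq_self] at this

theorem pd_eq_zero_of_notMem (hg : ContDiff ℝ ∞ g) (hf : ∀ p, f p = g fun c => p c) {c : ι}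
    (hc : c ∉ S) : pd c f = 0 := by
  funext p
  have : (fun d : S => (Pi.single c 1 : ι → ℝ) d) = 0 :=
    funext fun d => Pi.single_eq_of_ne (fun e => hc (by simp [← e])) _
  rw [pd_eq_fderiv_restrict hg hf, this, map_zero, Pi.zero_apply]

theorem fderiv_restrict_eq_sum (hg : ContDiff ℝ ∞ g) (hf : ∀ p, f p = g fun c => p c)
    (p v : ι → ℝ) : fderiv ℝ g (fun d => p d) (fun d => v d) = ∑ c ∈ S, v c * pd c f p := by
  rw [← ContinuousLinearMap.coe_coe, LinearMap.pi_apply_eq_sum_univ, ← Finset.sum_coe_sort S]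
  refine Finset.sum_congr rfl fun c _ => ?_
  rw [pd_eq_fderiv_restrict hg hf, smul_eq_mul, ContinuousLinearMap.coe_coe]
  congr 2
  funext d
  rw [Pi.single_apply]
  exact if_congr (by rw [Subtype.ext_iff, eq_comm]) rfl rfl

end Representation

namespace IsSmoothCyl

variable {f : (ι → ℝ) → ℝ}

theorem pd (hf : IsSmoothCyl f) (c : ι) : IsSmoothCyl (pd c f) := by
  obtain ⟨S, g, hg, hfg⟩ := hf
  exact ⟨S, _, (hg.fderiv_right (m := ∞) (by simp)).clm_apply contDiff_const,
    pd_eq_fderiv_restrict hg hfg c⟩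

theorem pd_comm (hf : IsSmoothCyl f) (c d : ι) :
    ViscousTransonic.pd c (ViscousTransonic.pd d f) =
      ViscousTransonic.pd d (ViscousTransonic.pd c f) := by
  obtain ⟨S, g, hg, hfg⟩ := hf
  have hg' : ContDiff ℝ ∞ (fderiv ℝ g) := hg.fderiv_right (by simp)
  have hpd (e : ι) : ContDiff ℝ ∞ fun q => fderiv ℝ g q fun d => (Pi.single e 1 : ι → ℝ) d :=
    hg'.clm_apply contDiff_const
  funext p
  have hdiff : DifferentiableAt ℝ (fderiv ℝ g) fun d => p d := hg'.differentiable (by simp) _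
  rw [pd_eq_fderiv_restrict (hpd d) (pd_eq_fderiv_restrict hg hfg d),
    pd_eq_fderiv_restrict (hpd c) (pd_eq_fderiv_restrict hg hfg c),
    fderiv_clm_apply hdiff (by fun_prop), fderiv_clm_apply hdiff (by fun_prop)]
  have hsymm : IsSymmSndFDerivAt ℝ g fun d => p d :=
    hg.contDiffAt.isSymmSndFDerivAt (by
      rw [minSmoothness_of_isRCLikeNormedField]; exact WithTop.coe_le_coe.2 le_top)
  simpa using hsymm _ _

theorem hasDerivAt_update (hf : IsSmoothCyl f) (c : ι) (p : ι → ℝ) :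
    HasDerivAt (fun s => f (Function.update p c s)) (ViscousTransonic.pd c f p) (p c) := by
  obtain ⟨S, g, hg, hfg⟩ := hf
  have := hasDerivAt_comp_of_eq_restrict hg hfg (hasDerivAt_update_apply p c · (p c))
  rwa [Function.update_eq_self, ← pd_eq_fderiv_restrict hg hfg] at this

end IsSmoothCyl

/-- The partial derivative as a derivation of the algebra of smooth cylinder functions. -/
noncomputable def pdDer (c : ι) : Derivation ℝ (SmoothCyl ι) (SmoothCyl ι) :=
  Derivation.mk'
    { toFun := fun f => .mk (pd c f) (f.isSmoothCyl.pd c)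
      map_add' := fun f g => SmoothCyl.ext fun p =>
        ((f.isSmoothCyl.hasDerivAt_update c p).add (g.isSmoothCyl.hasDerivAt_update c p)).deriv
      map_smul' := fun r f => SmoothCyl.ext fun p =>
        ((f.isSmoothCyl.hasDerivAt_update c p).const_mul r).deriv }
    (fun f g => by
      ext p
      have hmul :=
        ((f.isSmoothCyl.hasDerivAt_update c p).mul (g.isSmoothCyl.hasDerivAt_update c p)).deriv
      simp only [Function.update_eq_self] at hmul
      refine hmul.trans ?_
      simp only [LinearMap.coe_mk, AddHom.coe_mk, mk_apply, smul_eq_mul, add_apply, mul_apply]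
      ring)

theorem coe_pdDer (c : ι) (f : SmoothCyl ι) : ⇑(pdDer c f) = pd c f := rfl

theorem pdDer_comm (c d : ι) (f : SmoothCyl ι) : pdDer c (pdDer d f) = pdDer d (pdDer c f) :=
  SmoothCyl.ext (congrFun (f.isSmoothCyl.pd_comm c d))

theorem pdDer_coord (c d : ι) : pdDer c (coord d) = if d = c then 1 else 0 := by
  ext p
  refine (hasDerivAt_update_apply p c d (p c)).deriv.trans ?_
  rw [Pi.single_apply]
  split_ifs <;> rfl

theorem pdDer_eq_zero_of_update {c : ι} {f : SmoothCyl ι}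
    (h : ∀ p s, f (Function.update p c s) = f p) : pdDer c f = 0 := by
  ext p
  rw [coe_pdDer, pd, funext (h p), deriv_const, zero_apply]

theorem finite_support_pdDer (f : SmoothCyl ι) : (Function.support (pdDer · f)).Finite := by
  obtain ⟨S, g, hg, hfg⟩ := f.isSmoothCyl
  refine S.finite_toSet.subset fun c hc => by_contra fun h => hc ?_
  exact SmoothCyl.ext (congrFun (pd_eq_zero_of_notMem hg hfg h))

/-- The differential of a smooth cylinder function, as the family of its partial derivatives. -/
noncomputable def grad : Derivation ℝ (SmoothCyl ι) (ι →₀ SmoothCyl ι) :=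
  Derivation.mk'
    { toFun := fun f => Finsupp.ofSupportFinite (pdDer · f) (finite_support_pdDer f)
      map_add' := fun f g => Finsupp.ext fun c => map_add (pdDer c) f g
      map_smul' := fun r f => Finsupp.ext fun c => (pdDer c).map_smul r f }
    (fun f g => Finsupp.ext fun c => (pdDer c).leibniz f g)

@[simp] theorem grad_apply (f : SmoothCyl ι) (c : ι) : grad f c = pdDer c f := rfl

theorem pdDer_eq_zero_of_notMem_support {f : SmoothCyl ι} {c : ι} (hc : c ∉ (grad f).support) :
    pdDer c f = 0 := Finsupp.notMem_support_iff.1 hc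

theorem support_grad_pdDer_subset (c : ι) (f : SmoothCyl ι) :
    (grad (pdDer c f)).support ⊆ (grad f).support := by
  intro d hd
  contrapose hd
  rw [Finsupp.notMem_support_iff, grad_apply, pdDer_comm, pdDer_eq_zero_of_notMem_support hd,
    map_zero]

theorem grad_coord (c : ι) : grad (coord c) = Finsupp.single c 1 := by
  ext1 d
  rw [grad_apply, pdDer_coord, Finsupp.single_apply]

theorem hasDerivAt_comp_path (f : SmoothCyl ι) {γ : ℝ → ι → ℝ} {γ' : ι → ℝ} {s : ℝ}
    (hγ : ∀ c, HasDerivAt (γ · c) (γ' c) s) :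
    HasDerivAt (fun r => f (γ r)) ((grad f).sum fun c a => γ' c * a (γ s)) s := by
  obtain ⟨S, g, hg, hfg⟩ := f.isSmoothCyl
  have hsupp : (grad f).support ⊆ S := fun c hc => by_contra fun h =>
    Finsupp.mem_support_iff.1 hc (SmoothCyl.ext (congrFun (pd_eq_zero_of_notMem hg hfg h)))
  have hchain := hasDerivAt_comp_of_eq_restrict hg hfg hγ
  rw [fderiv_restrict_eq_sum hg hfg] at hchain
  rwa [Finsupp.sum_of_support_subset _ hsupp _ (by simp)]

end PartialDerivative

/-! ### Means along scalings -/

/-- The point `p` with the coordinate `c` scaled with weight `k c`. -/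
def scale {ι : Type} (k : ι → ℕ) (s : ℝ) (p : ι → ℝ) : ι → ℝ := fun c => s ^ k c * p c

section Mean

variable {ι : Type} (k : ι → ℕ)

theorem scale_one (p : ι → ℝ) : scale k 1 p = p := by
  funext c
  rw [scale, one_pow, one_mul]

theorem scale_update [DecidableEq ι] (s : ℝ) (p : ι → ℝ) (c : ι) (r : ℝ) :
    scale k s (Function.update p c r) = Function.update (scale k s p) c (s ^ k c * r) := by
  funext d
  rcases eq_or_ne d c with rfl | hd
  · simp [scale]
  · simp [scale, hd]

theorem contDiff_comp_scale {E : Type*} [NormedAddCommGroup E] [NormedSpace ℝ E]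
    (f : SmoothCyl ι) (j : ℕ) {σ : E → ℝ} {γ : E → ι → ℝ} (hσ : ContDiff ℝ ∞ σ)
    (hγ : ∀ c, ContDiff ℝ ∞ (γ · c)) : ContDiff ℝ ∞ fun x => σ x ^ j * f (scale k (σ x) (γ x)) :=
  (hσ.pow j).mul (f.isSmoothCyl.contDiff_comp fun c => (hσ.pow _).mul (hγ c))

theorem isSmoothCyl_integral_scale (j : ℕ) (f : SmoothCyl ι) :
    IsSmoothCyl fun p => ∫ s in (0 : ℝ)..1, s ^ j * f (scale k s p) := by
  obtain ⟨S, g, hg, hfg⟩ := f.isSmoothCyl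
  refine ⟨S, fun q => ∫ s in (0 : ℝ)..1, s ^ j * g fun c => s ^ k c * q c,
    contDiff_intervalIntegral ?_ 0 1, fun p => by simp only [hfg, scale]⟩
  exact (contDiff_snd.pow j).mul (hg.comp (by fun_prop))

theorem intervalIntegrable_scale (j : ℕ) (f : SmoothCyl ι) (p : ι → ℝ) :
    IntervalIntegrable (fun s => s ^ j * f (scale k s p)) MeasureTheory.volume 0 1 :=
  (contDiff_comp_scale k f j (σ := fun s => s) (γ := fun _ => p) contDiff_id
    fun _ => contDiff_const).continuous.intervalIntegrable 0 1

/-- The mean of a function over the points `scale k s p`, `0 ≤ s ≤ 1`, with weight `s ^ j`. -/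
noncomputable def mean (j : ℕ) : SmoothCyl ι →ₗ[ℝ] SmoothCyl ι where
  toFun f := mk (fun p => ∫ s in (0 : ℝ)..1, s ^ j * f (scale k s p))
    (isSmoothCyl_integral_scale k j f)
  map_add' f g := by
    ext p
    simp only [mk_apply, add_apply, mul_add]
    exact intervalIntegral.integral_add (intervalIntegrable_scale k j f p)
      (intervalIntegrable_scale k j g p)
  map_smul' r f := by
    ext p
    simp only [mk_apply, smul_apply, mul_left_comm _ r, intervalIntegral.integral_const_mul,
      RingHom.id_apply]

theorem mean_apply (j : ℕ) (f : SmoothCyl ι) (p : ι → ℝ) :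
    mean k j f p = ∫ s in (0 : ℝ)..1, s ^ j * f (scale k s p) := rfl

theorem mean_coord_mul (j : ℕ) (c : ι) (f : SmoothCyl ι) :
    mean k j (coord c * f) = coord c * mean k (j + k c) f := by
  ext p
  rw [mul_apply, mean_apply, mean_apply, coord_apply, ← intervalIntegral.integral_const_mul]
  refine intervalIntegral.integral_congr fun s _ => ?_
  simp only [mul_apply, coord_apply, scale, pow_add]
  ring

variable [DecidableEq ι]

theorem contDiff_update_apply (p : ι → ℝ) (c d : ι) :
    ContDiff ℝ ∞ fun r => Function.update p c r d := by
  simp only [Function.update_apply]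
  split_ifs
  · exact contDiff_id
  · exact contDiff_const

theorem pdDer_mean (j : ℕ) (c : ι) (f : SmoothCyl ι) :
    pdDer c (mean k j f) = mean k (j + k c) (pdDer c f) := by
  ext p
  refine (hasDerivAt_intervalIntegral_of_contDiff
    (f := fun r s => s ^ j * f (scale k s (Function.update p c r)))
    (f' := fun s => s ^ (j + k c) * pdDer c f (scale k s p)) ?_ (fun s => ?_) 0 1).deriv
  · exact (contDiff_comp_scale k f j contDiff_snd fun d =>
      (contDiff_update_apply p c d).comp contDiff_fst).of_le (by simp)
  · have houter := f.isSmoothCyl.hasDerivAt_update c (scale k s p)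
    have hinner := (hasDerivAt_id' (p c)).const_mul (s ^ k c)
    have := (HasDerivAt.comp (h := fun r => s ^ k c * r) (p c) houter hinner).const_mul (s ^ j)
    simp only [Function.comp_def, ← scale_update] at this
    exact this.congr_deriv (by rw [pow_add, coe_pdDer]; ring)

/-- The fundamental theorem of calculus along the path `s ↦ scale k s p`. -/
theorem sum_coord_mul_mean (f : SmoothCyl ι) (p : ι → ℝ) :
    ((grad f).sum fun c a => k c * p c * mean k (k c - 1) a p) = f p - f (scale k 0 p) := by
  have hderiv (s : ℝ) : HasDerivAt (fun s => f (scale k s p))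
      ((grad f).sum fun c a => k c * p c * (s ^ (k c - 1) * a (scale k s p))) s := by
    refine (hasDerivAt_comp_path f fun c => (hasDerivAt_pow (k c) s).mul_const (p c)).congr_deriv ?_
    exact Finset.sum_congr rfl fun c _ => by
      dsimp only; rw [mul_right_comm (k c : ℝ), mul_assoc]; rfl
  have hint (c : ι) : IntervalIntegrable
      (fun s => k c * p c * (s ^ (k c - 1) * grad f c (scale k s p))) MeasureTheory.volume 0 1 :=
    (intervalIntegrable_scale k _ _ p).const_mul _
  have hftc := intervalIntegral.integral_eq_sub_of_hasDerivAt (a := 0) (b := 1)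
    (fun s _ => hderiv s) (by
      simpa only [Finsupp.sum, Finset.sum_fn] using! IntervalIntegrable.sum _ fun c _ => hint c)
  rw [scale_one] at hftc
  rw [← hftc]
  simp only [Finsupp.sum]
  rw [intervalIntegral.integral_finsetSum fun c _ => hint c]
  simp only [intervalIntegral.integral_const_mul, mean_apply]

/-- The antiderivative in the coordinate `c`. -/
noncomputable def anti (c : ι) : SmoothCyl ι →ₗ[ℝ] SmoothCyl ι :=
  LinearMap.mulLeft ℝ (coord c) ∘ₗ mean (Pi.single c 1) 0

theorem anti_apply (c : ι) (f : SmoothCyl ι) (p : ι → ℝ) :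
    anti c f p = ∫ s in (0 : ℝ)..p c, f (Function.update p c s) := by
  have hsubst := intervalIntegral.smul_integral_comp_mul_right (a := 0) (b := 1)
    (fun s => f (Function.update p c s)) (p c)
  rw [zero_mul, one_mul] at hsubst
  have hscale (s : ℝ) : scale (Pi.single c 1) s p = Function.update p c (s * p c) := by
    funext d
    rcases eq_or_ne d c with rfl | hd
    · simp [scale]
    · simp [scale, hd]
  rw [← hsubst, anti, LinearMap.comp_apply, LinearMap.mulLeft_apply, mul_apply, mean_apply,
    coord_apply, smul_eq_mul]
  simp only [pow_zero, one_mul, hscale]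

theorem pdDer_anti_self (c : ι) (f : SmoothCyl ι) : pdDer c (anti c f) = f := by
  ext p
  have hcont : Continuous fun s => f (Function.update p c s) :=
    (f.isSmoothCyl.contDiff_comp (contDiff_update_apply p c)).continuous
  have := intervalIntegral.deriv_integral_right (hcont.intervalIntegrable 0 (p c))
    (hcont.stronglyMeasurableAtFilter _ _) hcont.continuousAt
  rw [Function.update_eq_self] at this
  rw [← this, coe_pdDer, pd]
  simp [anti_apply]

theorem pdDer_anti_of_ne {c d : ι} (hcd : c ≠ d) (f : SmoothCyl ι) :
    pdDer c (anti d f) = anti d (pdDer c f) := by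
  simp [anti, pdDer_mean, pdDer_coord, hcd, hcd.symm]

end Mean

/-! ### Vector fields -/

section VectorField

variable {ι : Type} [DecidableEq ι]

/-- The derivation `∑ c, X c ∂/∂c` defined by a vector field `X` on `ι → ℝ`. -/
noncomputable def vf (X : ι → SmoothCyl ι) : Derivation ℝ (SmoothCyl ι) (SmoothCyl ι) :=
  (Finsupp.linearCombination _ X).compDer grad

theorem vf_eq_sum (X : ι → SmoothCyl ι) (f : SmoothCyl ι) :
    vf X f = ∑ c ∈ (grad f).support, pdDer c f * X c := rfl

theorem vf_eq_sum_of_subset (X : ι → SmoothCyl ι) {f : SmoothCyl ι} {T : Finset ι}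
    (hT : (grad f).support ⊆ T) : vf X f = ∑ c ∈ T, pdDer c f * X c :=
  Finsupp.sum_of_support_subset (grad f) hT (fun c a => a • X c) (by simp)

theorem vf_coord (X : ι → SmoothCyl ι) (c : ι) : vf X (coord c) = X c := by
  simp [vf, grad_coord]

theorem vf_single_one (c : ι) : vf (Pi.single c 1) = pdDer c := by
  ext1 f
  rw [vf_eq_sum, Finset.sum_eq_single c]
  · simp
  · intro d _ hd
    simp [hd]
  · intro hc
    rw [pdDer_eq_zero_of_notMem_support hc, zero_mul]

theorem vf_sub (X Y : ι → SmoothCyl ι) : vf (X - Y) = vf X - vf Y := by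
  ext1 f
  simp only [vf_eq_sum, Derivation.sub_apply, Pi.sub_apply, mul_sub, Finset.sum_sub_distrib]

/-- The second order part of `vf X ∘ vf Y` is symmetric in `X` and `Y`. -/
theorem vf_vf (X Y : ι → SmoothCyl ι) (f : SmoothCyl ι) :
    vf X (vf Y f) = vf (fun c => vf X (Y c)) f +
      ∑ c ∈ (grad f).support, ∑ d ∈ (grad f).support, pdDer c (pdDer d f) * (X c * Y d) := by
  rw [vf_eq_sum Y, map_sum, Finset.sum_comm, vf_eq_sum, ← Finset.sum_add_distrib]
  refine Finset.sum_congr rfl fun d _ => ?_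
  rw [Derivation.leibniz, vf_eq_sum_of_subset X (support_grad_pdDer_subset d f), smul_eq_mul,
    smul_eq_mul, Finset.mul_sum]
  congr 1
  exact Finset.sum_congr rfl fun c _ => by ring

theorem bracket_vf (X Y : ι → SmoothCyl ι) :
    ⁅vf X, vf Y⁆ = vf fun c => vf X (Y c) - vf Y (X c) := by
  ext1 f
  rw [Derivation.commutator_apply, vf_vf, vf_vf Y X, Finset.sum_comm (s := (grad f).support)]
  simp only [pdDer_comm, mul_comm (X _)]
  rw [add_sub_add_right_eq_sub, ← Derivation.sub_apply, ← vf_sub]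
  rfl

theorem vf_comm {X Y : ι → SmoothCyl ι} (h : ∀ c, vf X (Y c) = vf Y (X c)) (f : SmoothCyl ι) :
    vf X (vf Y f) = vf Y (vf X f) := by
  have := DFunLike.congr_fun (bracket_vf X Y) f
  simpa [Derivation.commutator_apply, vf_eq_sum, h, sub_eq_zero] using this

theorem pdDer_vf (X : ι → SmoothCyl ι) (c : ι) (f : SmoothCyl ι) :
    pdDer c (vf X f) = vf X (pdDer c f) + vf (fun d => pdDer c (X d)) f := by
  have := DFunLike.congr_fun (bracket_vf (Pi.single c 1) X) f
  rw [vf_single_one, Derivation.commutator_apply, sub_eq_iff_eq_add'] at this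
  rw [this]
  congr 3
  funext d
  rcases eq_or_ne d c with rfl | hd
  · simp
  · simp [hd]

end VectorField

/-! ### Vertical forms -/

section VerticalForm

variable {β κ : Type}

/-- Vertical one-forms on the bundle `(β ⊕ κ → ℝ) → (β → ℝ)`, by their coefficients. -/
abbrev VerticalForm (β κ : Type) : Type := κ →₀ SmoothCyl (β ⊕ κ)

/-- Integration of vertical forms along the scaling of the fibres: the homotopy operator of the
vertical Poincaré lemma. -/
noncomputable def integ : VerticalForm β κ →ₗ[ℝ] SmoothCyl (β ⊕ κ) :=
  Finsupp.lsum ℝ fun a => LinearMap.mulLeft ℝ (coord (Sum.inr a)) ∘ₗ mean (Sum.elim 0 1) 0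

theorem integ_single (a : κ) (g : SmoothCyl (β ⊕ κ)) :
    integ (Finsupp.single a g) = coord (Sum.inr a) * mean (Sum.elim 0 1) 0 g := by
  rw [integ, Finsupp.lsum_single]
  rfl

variable [DecidableEq β] [DecidableEq κ]

/-- The vertical differential. -/
noncomputable def dV : Derivation ℝ (SmoothCyl (β ⊕ κ)) (VerticalForm β κ) :=
  (Finsupp.lcomapDomain Sum.inr Sum.inr_injective :
    (β ⊕ κ →₀ SmoothCyl (β ⊕ κ)) →ₗ[SmoothCyl (β ⊕ κ)] VerticalForm β κ).compDer grad

@[simp] theorem dV_apply (f : SmoothCyl (β ⊕ κ)) (a : κ) : dV f a = pdDer (Sum.inr a) f := rfl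

theorem dV_coord_inr (a : κ) : dV (coord (Sum.inr a : β ⊕ κ)) = Finsupp.single a 1 := by
  ext1 b
  simp [pdDer_coord, Finsupp.single_apply]

theorem support_dV (f : SmoothCyl (β ⊕ κ)) : (dV f).support = (grad f).support.toRight := by
  ext a
  simp

theorem vf_eq_sum_add_sum [Fintype β] (X : β ⊕ κ → SmoothCyl (β ⊕ κ)) (f : SmoothCyl (β ⊕ κ)) :
    vf X f = ∑ j, pdDer (Sum.inl j) f * X (Sum.inl j) +
      ∑ a ∈ (dV f).support, pdDer (Sum.inr a) f * X (Sum.inr a) := by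
  rw [vf_eq_sum_of_subset X (T := Finset.univ.disjSum (dV f).support), Finset.sum_disjSum]
  rintro (j | a) hc
  · simp
  · simpa using hc

theorem vf_eq_linearCombination_dV {X : β ⊕ κ → SmoothCyl (β ⊕ κ)}
    (hX : ∀ j, X (Sum.inl j) = 0) (f : SmoothCyl (β ⊕ κ)) :
    vf X f = Finsupp.linearCombination _ (fun a => X (Sum.inr a)) (dV f) := by
  suffices Finsupp.linearCombination (SmoothCyl (β ⊕ κ)) X =
      Finsupp.linearCombination _ (fun a => X (Sum.inr a)) ∘ₗ
        Finsupp.lcomapDomain Sum.inr Sum.inr_injective from LinearMap.congr_fun this (grad f)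
  refine Finsupp.lhom_ext' fun c => LinearMap.ext_ring ?_
  rcases c with j | a
  · have : Finsupp.comapDomain Sum.inr (Finsupp.single (Sum.inl j) (1 : SmoothCyl (β ⊕ κ)))
        Sum.inr_injective.injOn = (0 : VerticalForm β κ) := by
      ext1 b
      simp
    simp [Finsupp.lcomapDomain, hX, this]
  · simp [Finsupp.lcomapDomain, Finsupp.comapDomain_single]

/-- The Lie derivative of vertical forms along a vector field projecting to `β → ℝ`. -/
noncomputable def lie (X : β ⊕ κ → SmoothCyl (β ⊕ κ)) :
    VerticalForm β κ →ₗ[ℝ] VerticalForm β κ :=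
  Finsupp.mapRange.linearMap (vf X).toLinearMap +
    (Finsupp.linearCombination _ fun a => dV (X (Sum.inr a))).restrictScalars ℝ

theorem lie_single (X : β ⊕ κ → SmoothCyl (β ⊕ κ)) (a : κ) (g : SmoothCyl (β ⊕ κ)) :
    lie X (Finsupp.single a g) = Finsupp.single a (vf X g) + g • dV (X (Sum.inr a)) := by
  simp [lie]

theorem lie_smul (X : β ⊕ κ → SmoothCyl (β ⊕ κ)) (g : SmoothCyl (β ⊕ κ)) (θ : VerticalForm β κ) :
    lie X (g • θ) = vf X g • θ + g • lie X θ := by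
  induction θ using Finsupp.induction_linear with
  | zero => simp
  | add θ θ' h h' =>
    rw [smul_add, map_add, map_add, h, h', smul_add, smul_add]
    abel
  | single a r =>
    rw [Finsupp.smul_single, lie_single, lie_single, smul_eq_mul, Derivation.leibniz,
      smul_add, smul_smul, Finsupp.smul_single, Finsupp.smul_single, Finsupp.single_add,
      smul_eq_mul, smul_eq_mul, smul_eq_mul, mul_comm r]
    abel

theorem lie_dV {X : β ⊕ κ → SmoothCyl (β ⊕ κ)} (hX : ∀ j, dV (X (Sum.inl j)) = 0)
    (f : SmoothCyl (β ⊕ κ)) : lie X (dV f) = dV (vf X f) := by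
  ext1 d
  have hvf : vf (fun c => pdDer (Sum.inr d) (X c)) f =
      Finsupp.linearCombination _ (fun a => dV (X (Sum.inr a)) d) (dV f) :=
    vf_eq_linearCombination_dV (fun j => DFunLike.congr_fun (hX j) d) f
  have hcoeff := Finsupp.apply_linearCombination (SmoothCyl (β ⊕ κ))
    (Finsupp.lapply d : VerticalForm β κ →ₗ[SmoothCyl (β ⊕ κ)] _)
    (fun a => dV (X (Sum.inr a))) (dV f)
  rw [dV_apply, pdDer_vf, hvf, lie, LinearMap.add_apply, Finsupp.add_apply]
  exact congrArg₂ _ rfl hcoeff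

theorem lie_comm {X Y : β ⊕ κ → SmoothCyl (β ⊕ κ)} (h : ∀ c, vf X (Y c) = vf Y (X c))
    (hX : ∀ j, dV (X (Sum.inl j)) = 0) (hY : ∀ j, dV (Y (Sum.inl j)) = 0)
    (θ : VerticalForm β κ) : lie X (lie Y θ) = lie Y (lie X θ) := by
  induction θ using Finsupp.induction_linear with
  | zero => simp
  | add θ θ' h h' => simp only [map_add, h, h']
  | single a r =>
    simp only [lie_single, map_add, lie_smul, lie_dV hX, lie_dV hY, h, vf_comm h]
    abel

theorem vf_eq_of_dV_eq_zero [Fintype β] (X : β ⊕ κ → SmoothCyl (β ⊕ κ)) {f : SmoothCyl (β ⊕ κ)}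
    (hf : dV f = 0) : vf X f = ∑ j, pdDer (Sum.inl j) f * X (Sum.inl j) := by
  rw [vf_eq_sum_add_sum, hf, Finsupp.support_zero, Finset.sum_empty, add_zero]

theorem dV_anti (j : β) {f : SmoothCyl (β ⊕ κ)} (hf : dV f = 0) :
    dV (anti (Sum.inl j) f) = 0 := by
  ext1 a
  rw [dV_apply, pdDer_anti_of_ne Sum.inr_ne_inl, ← dV_apply, hf, Finsupp.zero_apply, map_zero]

/-! ### Restriction to the zero section -/

theorem integ_dV (f : SmoothCyl (β ⊕ κ)) (p : β ⊕ κ → ℝ) :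
    integ (dV f) p = f p - f (Sum.elim (fun j => p (Sum.inl j)) 0) := by
  have hscale : scale (Sum.elim 0 1) 0 p = Sum.elim (fun j => p (Sum.inl j)) 0 := by
    funext c
    rcases c with j | a <;> simp [scale]
  rw [← hscale, ← sum_coord_mul_mean, Finsupp.sum,
    ← Finset.toLeft_disjSum_toRight (u := (grad f).support), Finset.sum_disjSum, ← support_dV,
    integ, Finsupp.lsum_apply, Finsupp.sum, sum_apply]
  simp

/-- The restriction of a function to the zero section, extended constantly along the fibres. -/
noncomputable def base (f : SmoothCyl (β ⊕ κ)) : SmoothCyl (β ⊕ κ) := f - integ (dV f)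

theorem base_apply (f : SmoothCyl (β ⊕ κ)) (p : β ⊕ κ → ℝ) :
    base f p = f (Sum.elim (fun j => p (Sum.inl j)) 0) := by
  rw [base, sub_apply, integ_dV, sub_sub_cancel]

theorem dV_base (f : SmoothCyl (β ⊕ κ)) : dV (base f) = 0 :=
  Finsupp.ext fun a => pdDer_eq_zero_of_update fun p s => by simp [base_apply]

end VerticalForm

/-! ### Total derivatives on the equation -/

/-- Indices of the derivatives of `v` which are internal coordinates: the order in `y` and the
orders in `x`, `z`, `t`. -/
abbrev Jet : Type := Fin 2 × (Fin 3 → ℕ)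

/-- Vertical one-forms on the equation. -/
abbrev VForm : Type := VerticalForm (Fin 4) Jet

/-- The vector field of the total derivative in `x`, `z`, `t`. -/
noncomputable def spaceField (i : Fin 3) : Coord → SmoothCyl Coord :=
  Sum.elim (fun j => if j = i.succ then 1 else 0)
    (fun a => coord (Sum.inr (a.1, a.2 + Pi.single i 1)))

theorem spaceField_inr (i : Fin 3) (a : Jet) :
    spaceField i (Sum.inr a) = coord (Sum.inr (a.1, a.2 + Pi.single i 1)) := rfl

theorem dV_spaceField_inl (i : Fin 3) (j : Fin 4) : dV (spaceField i (Sum.inl j)) = 0 := by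
  simp only [spaceField, Sum.elim_inl]
  split_ifs <;> simp

theorem spaceField_comm (i j : Fin 3) (c : Coord) :
    vf (spaceField i) (spaceField j c) = vf (spaceField j) (spaceField i c) := by
  rcases c with k | a
  · simp only [spaceField, Sum.elim_inl]
    split_ifs <;> simp
  · simp only [spaceField, Sum.elim_inr, vf_coord, add_right_comm]

/-- The total derivative in `x`, `z`, `t`: `spaceD` on the algebra of smooth functions. -/
noncomputable abbrev D (i : Fin 3) : Derivation ℝ (SmoothCyl Coord) (SmoothCyl Coord) :=
  vf (spaceField i)

/-- The Lie derivative along the total derivative in `x`, `z`, `t`. -/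
noncomputable abbrev LD (i : Fin 3) : VForm →ₗ[ℝ] VForm := lie (spaceField i)

theorem D_comm (i j : Fin 3) (f : SmoothCyl Coord) : D i (D j f) = D j (D i f) :=
  vf_comm (spaceField_comm i j) f

theorem LD_comm (i j : Fin 3) (θ : VForm) : LD i (LD j θ) = LD j (LD i θ) :=
  lie_comm (spaceField_comm i j) (dV_spaceField_inl i) (dV_spaceField_inl j) θ

theorem LD_dV (i : Fin 3) (f : SmoothCyl Coord) : LD i (dV f) = dV (D i f) :=
  lie_dV (dV_spaceField_inl i) f

theorem dV_D_eq_zero (i : Fin 3) {f : SmoothCyl Coord} (hf : dV f = 0) : dV (D i f) = 0 := by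
  rw [← LD_dV, hf, map_zero]

theorem LD_single (i : Fin 3) (a : Jet) (g : SmoothCyl Coord) :
    LD i (Finsupp.single a g) =
      Finsupp.single a (D i g) + Finsupp.single (a.1, a.2 + Pi.single i 1) g := by
  rw [lie_single, spaceField_inr, dV_coord_inr, Finsupp.smul_single_one]

theorem D_eq_add_sum (i : Fin 3) (f : SmoothCyl Coord) :
    D i f = pdDer (Sum.inl i.succ) f +
      ∑ a ∈ (dV f).support, coord (Sum.inr (a.1, a.2 + Pi.single i 1)) * dV f a := by
  rw [vf_eq_sum_add_sum]
  congr 1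
  · simp [spaceField]
  · exact Finset.sum_congr rfl fun a _ => mul_comm _ _

theorem D_of_dV_eq_zero (i : Fin 3) {f : SmoothCyl Coord} (hf : dV f = 0) :
    D i f = pdDer (Sum.inl i.succ) f := by
  rw [D_eq_add_sum, hf, Finsupp.support_zero, Finset.sum_empty, add_zero]

/-- The iterated total derivative: `spaceDIter` on the algebra of smooth functions. -/
noncomputable def DI (I : Fin 3 → ℕ) : Module.End ℝ (SmoothCyl Coord) :=
  (D 0).toLinearMap ^ I 0 * ((D 1).toLinearMap ^ I 1 * (D 2).toLinearMap ^ I 2)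

@[simp] theorem DI_zero : DI 0 = 1 := by simp [DI]

theorem commute_D (i j : Fin 3) :
    Commute (D i).toLinearMap ((D j).toLinearMap : Module.End ℝ (SmoothCyl Coord)) :=
  LinearMap.ext (D_comm i j)

theorem DI_add_single (I : Fin 3 → ℕ) (i : Fin 3) :
    DI (I + Pi.single i 1) = DI I * (D i).toLinearMap := by
  have h01 := (commute_D 0 1).pow_right (I 1)
  have h02 := (commute_D 0 2).pow_right (I 2)
  have h12 := (commute_D 1 2).pow_right (I 2)
  fin_cases i
  · simp [DI, pow_succ, mul_assoc, (h01.mul_right h02).eq]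
  · simp [DI, pow_succ, mul_assoc, h12.eq]
  · simp [DI, pow_succ, mul_assoc]

theorem DI_D (I : Fin 3 → ℕ) (i : Fin 3) (f : SmoothCyl Coord) :
    DI I (D i f) = DI (I + Pi.single i 1) f := by
  rw [DI_add_single]; rfl

theorem D_DI (I : Fin 3 → ℕ) (i : Fin 3) (f : SmoothCyl Coord) :
    D i (DI I f) = DI (I + Pi.single i 1) f := by
  have hcomm : Commute (D i).toLinearMap (DI I) :=
    ((commute_D i 0).pow_right _).mul_right
      (((commute_D i 1).pow_right _).mul_right ((commute_D i 2).pow_right _))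
  rw [← DI_D]
  exact LinearMap.congr_fun hcomm.eq f

/-- The derivative `∂_y^s ∂_x^a ∂_z^b ∂_t^c v`. -/
def jetFn (s : Fin 2) (a b c : ℕ) : SmoothCyl Coord := coord (Sum.inr (s, ![a, b, c]))

/-- The right-hand side of the equation. -/
noncomputable def rhsFn (μ : ℝ) : SmoothCyl Coord :=
  2 * jetFn 0 1 0 1 + jetFn 0 1 0 0 * jetFn 0 2 0 0 - jetFn 0 0 2 0 - μ • jetFn 0 3 0 0

theorem coe_rhsFn (μ : ℝ) : ⇑(rhsFn μ) = rhs μ := rfl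

/-- The vector field of the total derivative in `y` on the equation. -/
noncomputable def evolField (μ : ℝ) : Coord → SmoothCyl Coord :=
  Sum.elim (fun j => if j = 0 then 1 else 0)
    (fun a => if a.1 = 0 then coord (Sum.inr (1, a.2)) else DI a.2 (rhsFn μ))

theorem evolField_zero (μ : ℝ) (I : Fin 3 → ℕ) :
    evolField μ (Sum.inr (0, I)) = coord (Sum.inr (1, I)) := rfl

theorem evolField_one (μ : ℝ) (I : Fin 3 → ℕ) :
    evolField μ (Sum.inr (1, I)) = DI I (rhsFn μ) := rfl

theorem dV_evolField_inl (μ : ℝ) (j : Fin 4) : dV (evolField μ (Sum.inl j)) = 0 := by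
  simp only [evolField, Sum.elim_inl]
  split_ifs <;> simp

theorem evolField_comm (μ : ℝ) (i : Fin 3) (c : Coord) :
    vf (evolField μ) (spaceField i c) = vf (spaceField i) (evolField μ c) := by
  rcases c with k | ⟨s, I⟩
  · simp only [spaceField, evolField, Sum.elim_inl]
    split_ifs <;> simp
  · simp only [spaceField, Sum.elim_inr, vf_coord, evolField]
    split_ifs
    · rw [vf_coord]
      rfl
    · exact (D_DI I i _).symm

/-- The total derivative in `y` on the equation: `evolD` on the algebra of smooth functions. -/
noncomputable abbrev Dy (μ : ℝ) : Derivation ℝ (SmoothCyl Coord) (SmoothCyl Coord) :=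
  vf (evolField μ)

/-- The Lie derivative along the total derivative in `y` on the equation. -/
noncomputable abbrev LDy (μ : ℝ) : VForm →ₗ[ℝ] VForm := lie (evolField μ)

theorem Dy_D (μ : ℝ) (i : Fin 3) (f : SmoothCyl Coord) : Dy μ (D i f) = D i (Dy μ f) :=
  vf_comm (evolField_comm μ i) f

theorem LDy_LD (μ : ℝ) (i : Fin 3) (θ : VForm) : LDy μ (LD i θ) = LD i (LDy μ θ) :=
  lie_comm (evolField_comm μ i) (dV_evolField_inl μ) (dV_spaceField_inl i) θ

theorem LDy_dV (μ : ℝ) (f : SmoothCyl Coord) : LDy μ (dV f) = dV (Dy μ f) :=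
  lie_dV (dV_evolField_inl μ) f

theorem dV_Dy_eq_zero (μ : ℝ) {f : SmoothCyl Coord} (hf : dV f = 0) : dV (Dy μ f) = 0 := by
  rw [← LDy_dV, hf, map_zero]

theorem LDy_single_zero (μ : ℝ) (I : Fin 3 → ℕ) (g : SmoothCyl Coord) :
    LDy μ (Finsupp.single (0, I) g) =
      Finsupp.single (0, I) (Dy μ g) + Finsupp.single (1, I) g := by
  rw [lie_single, evolField_zero, dV_coord_inr, Finsupp.smul_single_one]

theorem LDy_single_one (μ : ℝ) (I : Fin 3 → ℕ) (g : SmoothCyl Coord) :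
    LDy μ (Finsupp.single (1, I) g) =
      Finsupp.single (1, I) (Dy μ g) + g • dV (DI I (rhsFn μ)) := by
  rw [lie_single, evolField_one]

theorem Dy_of_dV_eq_zero (μ : ℝ) {f : SmoothCyl Coord} (hf : dV f = 0) :
    Dy μ f = pdDer (Sum.inl 0) f := by
  simp [vf_eq_of_dV_eq_zero _ hf, evolField]

/-! ### Comparison with the total derivatives of the statement -/

theorem coe_D (i : Fin 3) (f : SmoothCyl Coord) : ⇑(D i f) = spaceD i f := by
  funext p
  rw [spaceD, finsum_eq_sum_of_support_subset (s := (dV f).support), D_eq_add_sum]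
  · simp [coe_pdDer]
  · intro a ha
    rw [Finset.mem_coe, Finsupp.mem_support_iff]
    rintro h
    exact ha (by dsimp only; rw [← coe_pdDer, ← dV_apply, h, zero_apply, mul_zero])

theorem coe_DI (I : Fin 3 → ℕ) (f : SmoothCyl Coord) : ⇑(DI I f) = spaceDIter I f := by
  have hpow (i : Fin 3) (n : ℕ) (f : SmoothCyl Coord) :
      ⇑(((D i).toLinearMap ^ n : Module.End ℝ (SmoothCyl Coord)) f) = (spaceD i)^[n] f := by
    rw [Module.End.pow_apply]
    exact (Function.Semiconj.iterate_right (f := fun f : SmoothCyl Coord => ⇑f) (coe_D i) n) f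
  simp only [DI, Module.End.mul_apply, hpow, spaceDIter]

theorem finsum_mul_pd_inr (s : Fin 2) (X : (Fin 3 → ℕ) → SmoothCyl Coord) (f : SmoothCyl Coord)
    (p : Pt) : ∑ᶠ I, X I p * pd (Sum.inr (s, I)) f p =
      ∑ I ∈ (dV f).support.image Prod.snd, X I p * pdDer (Sum.inr (s, I)) f p := by
  rw [finsum_eq_sum_of_support_subset (s := (dV f).support.image Prod.snd)]
  · rfl
  · intro I hI
    rw [Finset.mem_coe]
    refine Finset.mem_image.2 ⟨(s, I), Finsupp.mem_support_iff.2 fun h => ?_, rfl⟩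
    exact hI (by dsimp only; rw [← coe_pdDer, ← dV_apply, h, zero_apply, mul_zero])

theorem coe_Dy (μ : ℝ) (f : SmoothCyl Coord) : ⇑(Dy μ f) = evolD μ f := by
  funext p
  have hsupp : (dV f).support ⊆ Finset.univ ×ˢ (dV f).support.image Prod.snd := fun a ha =>
    Finset.mem_product.2 ⟨Finset.mem_univ _, Finset.mem_image_of_mem _ ha⟩
  have h0 := finsum_mul_pd_inr 0 (fun I => coord (Sum.inr (1, I))) f p
  have h1 := finsum_mul_pd_inr 1 (fun I => DI I (rhsFn μ)) f p
  simp only [coord_apply, coe_DI, coe_rhsFn] at h0 h1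
  rw [evolD, h0, h1, vf_eq_sum_add_sum, Finset.sum_subset hsupp, Finset.sum_product,
    Fin.sum_univ_two]
  · simp [evolField, mul_comm, coe_DI, coe_rhsFn, coe_pdDer, add_assoc]
  · intro a _ ha
    rw [← dV_apply, Finsupp.notMem_support_iff.1 ha, zero_mul]

/-! ### The Euler operator -/

section MultiIndex

variable {ι : Type} [DecidableEq ι]

theorem exists_eq_add_single {I : ι → ℕ} {i : ι} (h : I i ≠ 0) :
    ∃ I' : ι → ℕ, I = I' + Pi.single i 1 := by
  refine ⟨I - Pi.single i 1, (tsub_add_cancel_of_le fun j => ?_).symm⟩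
  rcases eq_or_ne j i with rfl | hj
  · simpa [Nat.one_le_iff_ne_zero] using h
  · simp [hj]

theorem sum_add_single [Fintype ι] (I : ι → ℕ) (i : ι) :
    ∑ j, (I + Pi.single i 1 : ι → ℕ) j = ∑ j, I j + 1 := by
  simp [Finset.sum_add_distrib]

theorem multiIndex_induction [Finite ι] {P : (ι → ℕ) → Prop} (zero : P 0)
    (add_single : ∀ I i, P I → P (I + Pi.single i 1)) (I : ι → ℕ) : P I := by
  have := Fintype.ofFinite ι
  induction hn : ∑ j, I j generalizing I with
  | zero => rwa [show I = 0 from funext (by simpa using hn)]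
  | succ n ih =>
    obtain ⟨i, -, hi⟩ := Finset.exists_ne_zero_of_sum_ne_zero (hn.trans_ne n.succ_ne_zero)
    obtain ⟨I', rfl⟩ := exists_eq_add_single hi
    exact add_single I' i (ih I' (by rwa [sum_add_single, Nat.add_right_cancel_iff] at hn))

end MultiIndex

/-- The formal adjoint of an iterated total derivative. -/
noncomputable def adjDI (I : Fin 3 → ℕ) : Module.End ℝ (SmoothCyl Coord) :=
  (-1 : ℝ) ^ (∑ i, I i) • DI I

theorem adjDI_zero : adjDI 0 = 1 := by simp [adjDI]

theorem adjDI_add_single (I : Fin 3 → ℕ) (i : Fin 3) (f : SmoothCyl Coord) :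
    adjDI (I + Pi.single i 1) f = -adjDI I (D i f) := by
  simp only [adjDI, sum_add_single, pow_succ, mul_neg_one, LinearMap.smul_apply, DI_D, neg_smul]

/-- The Euler operator of `v` (`s = 0`) or of `v_y` (`s = 1`): integration by parts in the
variables `x`, `z`, `t` sends `g dv_I` to `(-D)^I g`. -/
noncomputable def euler (s : Fin 2) : VForm →ₗ[ℝ] SmoothCyl Coord :=
  Finsupp.lsum ℝ fun a => if a.1 = s then adjDI a.2 else 0

theorem euler_single (s : Fin 2) (a : Jet) (g : SmoothCyl Coord) :
    euler s (Finsupp.single a g) = if a.1 = s then adjDI a.2 g else 0 := by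
  rw [euler, Finsupp.lsum_single]
  split_ifs <;> rfl

theorem euler_LD (s : Fin 2) (i : Fin 3) (θ : VForm) : euler s (LD i θ) = 0 := by
  induction θ using Finsupp.induction_linear with
  | zero => simp
  | add θ θ' h h' => rw [map_add, map_add, h, h', add_zero]
  | single a r =>
    rw [LD_single, map_add, euler_single, euler_single]
    split_ifs
    · rw [adjDI_add_single, add_neg_cancel]
    · exact add_zero 0

/-- The divergence of vertical forms in the variables `x`, `z`, `t`. -/
noncomputable def divV : (Fin 3 → VForm) →ₗ[ℝ] VForm := LinearMap.lsum ℝ (fun _ => VForm) ℝ LD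

theorem divV_apply (θ : Fin 3 → VForm) : divV θ = ∑ i, LD i (θ i) := by simp [divV]

theorem LD_mem_range_divV (i : Fin 3) (θ : VForm) : LD i θ ∈ LinearMap.range divV :=
  ⟨Pi.single i θ, LinearMap.lsum_piSingle ..⟩

theorem single_sub_single_adjDI_mem_range_divV (s : Fin 2) (I : Fin 3 → ℕ)
    (g : SmoothCyl Coord) :
    Finsupp.single (s, I) g - Finsupp.single (s, 0) (adjDI I g) ∈ LinearMap.range divV := by
  induction I using multiIndex_induction generalizing g with
  | zero => simp [adjDI_zero]
  | add_single I i ih =>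
    have := sub_mem (LD_mem_range_divV i (Finsupp.single (s, I) g)) (ih (D i g))
    rw [LD_single] at this
    convert this using 1
    rw [adjDI_add_single, Finsupp.single_neg]
    abel

theorem sub_sum_single_euler_mem_range_divV (θ : VForm) :
    θ - ∑ s, Finsupp.single (s, 0) (euler s θ) ∈ LinearMap.range divV := by
  induction θ using Finsupp.induction_linear with
  | zero => simp
  | add θ θ' h h' =>
    convert add_mem h h' using 1
    simp only [map_add, Finsupp.single_add, Finset.sum_add_distrib]
    abel
  | single a r =>
    convert single_sub_single_adjDI_mem_range_divV a.1 a.2 r using 2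
    rw [Finset.sum_eq_single a.1]
    · simp [euler_single]
    · intro s _ hs
      simp [euler_single, hs.symm]
    · simp

/-! ### Exactness of the horizontal complex of vertical forms -/

theorem map_mem_of_support_subset {κ M N F σ : Type*} [AddCommMonoid M] [AddCommMonoid N]
    [FunLike F (κ →₀ M) N] [AddMonoidHomClass F (κ →₀ M) N] [SetLike σ N] [AddSubmonoidClass σ N]
    {φ : F} {s : Set κ} {P : σ} (h : ∀ a ∈ s, ∀ g, φ (Finsupp.single a g) ∈ P) {θ : κ →₀ M}
    (hθ : ↑θ.support ⊆ s) : φ θ ∈ P := by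
  rw [← θ.sum_single, Finsupp.sum, map_sum]
  exact sum_mem fun a ha => h a (hθ ha) _

/-- The vertical forms without derivatives in the variable `x`, `z`, `t` for `i = 0`, `1`, `2`. -/
noncomputable def noDeriv (i : Fin 3) : Submodule ℝ VForm := Finsupp.supported _ ℝ {a | a.2 i = 0}

theorem single_mem_noDeriv {i : Fin 3} {a : Jet} (ha : a.2 i = 0) (g : SmoothCyl Coord) :
    Finsupp.single a g ∈ noDeriv i :=
  Finsupp.single_mem_supported ℝ g ha

theorem LD_mem_noDeriv {i j : Fin 3} (hij : i ≠ j) {θ : VForm} (h : θ ∈ noDeriv i) :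
    LD j θ ∈ noDeriv i := by
  refine map_mem_of_support_subset (s := {a : Jet | a.2 i = 0}) (fun a ha g => ?_)
    ((Finsupp.mem_supported ℝ θ).1 h)
  have ha : a.2 i = 0 := ha
  rw [LD_single]
  exact add_mem (single_mem_noDeriv ha _) (single_mem_noDeriv (by simp [ha, hij]) _)

theorem single_mem_range_LD_sup_noDeriv (i : Fin 3) (a : Jet) (g : SmoothCyl Coord) :
    Finsupp.single a g ∈ LinearMap.range (LD i) ⊔ noDeriv i := by
  obtain ⟨s, I⟩ := a
  induction hn : I i generalizing I g with
  | zero => exact Submodule.mem_sup_right (single_mem_noDeriv hn g)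
  | succ n ih =>
    obtain ⟨I', rfl⟩ := exists_eq_add_single (hn.trans_ne n.succ_ne_zero)
    have hLD := LinearMap.mem_range_self (LD i) (Finsupp.single (s, I') g)
    have := sub_mem (Submodule.mem_sup_left hLD) (ih (D i g) I' (by simpa using hn))
    rwa [LD_single, add_sub_cancel_left] at this

theorem exists_LD_add_noDeriv (i : Fin 3) (θ : VForm) :
    ∃ h, ∃ θ₀ ∈ noDeriv i, θ = LD i h + θ₀ := by
  have hθ : θ ∈ LinearMap.range (LD i) ⊔ noDeriv i :=
    map_mem_of_support_subset (φ := AddMonoidHom.id VForm)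
      (fun a _ g => single_mem_range_LD_sup_noDeriv i a g) (Set.subset_univ _)
  obtain ⟨_, ⟨h, rfl⟩, θ₀, h₀, rfl⟩ := Submodule.mem_sup.1 hθ
  exact ⟨h, θ₀, h₀, rfl⟩

theorem LD_apply_add_single (i : Fin 3) (θ : VForm) (a : Jet) :
    LD i θ (a.1, a.2 + Pi.single i 1) = D i (θ (a.1, a.2 + Pi.single i 1)) + θ a := by
  induction θ using Finsupp.induction_linear with
  | zero => simp
  | add θ θ' h h' =>
    rw [map_add, Finsupp.add_apply, h, h', Finsupp.add_apply, map_add, Finsupp.add_apply]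
    abel
  | single b r =>
    rw [LD_single, Finsupp.add_apply]
    congr 1
    · rw [Finsupp.single_apply, Finsupp.single_apply]
      split_ifs <;> simp
    · simp only [Finsupp.single_apply, Prod.ext_iff, add_left_inj]

theorem eq_zero_of_LD_mem_noDeriv {i : Fin 3} {θ : VForm} (h : LD i θ ∈ noDeriv i) : θ = 0 := by
  by_contra hθ
  obtain ⟨a, ha, hmax⟩ := θ.support.exists_max_image (fun a => a.2 i)
    (Finsupp.support_nonempty_iff.2 hθ)
  have hnext : θ (a.1, a.2 + Pi.single i 1) = 0 := by
    by_contra h'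
    simpa using hmax _ (Finsupp.mem_support_iff.2 h')
  have hLD : LD i θ (a.1, a.2 + Pi.single i 1) = 0 :=
    (Finsupp.mem_supported' ℝ _).1 h _ (by simp)
  rw [LD_apply_add_single, hnext, map_zero, zero_add] at hLD
  exact Finsupp.mem_support_iff.1 ha hLD

theorem exists_curl_of_div_eq_zero_vForm {a b c : VForm} (h : LD 0 a + LD 1 b + LD 2 c = 0) :
    ∃ l m n : VForm, a = -LD 1 l - LD 2 m ∧ b = LD 0 l - LD 2 n ∧ c = LD 0 m + LD 1 n := by
  obtain ⟨l, b₀, hb₀, rfl⟩ := exists_LD_add_noDeriv 0 b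
  obtain ⟨m, c₀, hc₀, rfl⟩ := exists_LD_add_noDeriv 0 c
  obtain ⟨n, c₁, hc₁, rfl⟩ := exists_LD_add_noDeriv 1 c₀
  have e1 : LD 0 (a + LD 1 l + LD 2 m) = -(LD 1 b₀ + LD 2 (LD 1 n + c₁)) := by
    rw [eq_neg_iff_add_eq_zero, ← h]
    simp only [map_add]
    rw [LD_comm 0 1 l, LD_comm 0 2 m]
    abel
  have ha : a + LD 1 l + LD 2 m = 0 := eq_zero_of_LD_mem_noDeriv (i := 0) <| e1 ▸ neg_mem
    (add_mem (LD_mem_noDeriv (by decide) hb₀) (LD_mem_noDeriv (by decide) hc₀))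
  rw [ha, map_zero, eq_comm, neg_eq_zero] at e1
  have e2 : LD 1 (b₀ + LD 2 n) = -LD 2 c₁ := by
    rw [eq_neg_iff_add_eq_zero, ← e1]
    simp only [map_add]
    rw [LD_comm 1 2 n]
    abel
  have hb : b₀ + LD 2 n = 0 := eq_zero_of_LD_mem_noDeriv (i := 1) <|
    e2 ▸ neg_mem (LD_mem_noDeriv (by decide) hc₁)
  rw [hb, map_zero, eq_comm, neg_eq_zero] at e2
  have hc : c₁ = 0 := eq_zero_of_LD_mem_noDeriv (i := 2) (e2 ▸ zero_mem _)
  refine ⟨l, m, n, ?_, ?_, ?_⟩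
  · rw [← sub_eq_zero, ← ha]; abel
  · rw [eq_neg_of_add_eq_zero_left hb]; abel
  · rw [hc]; abel

/-! ### Exactness of the horizontal complex of functions -/

theorem D_mean (i : Fin 3) (f : SmoothCyl Coord) :
    D i (mean (Sum.elim 0 1) 0 f) = mean (Sum.elim 0 1) 0 (D i f) := by
  have hsupp : (dV (mean (Sum.elim 0 1) 0 f)).support ⊆ (dV f).support := fun a ha => by
    rw [Finsupp.mem_support_iff] at ha ⊢
    contrapose! ha
    rw [dV_apply, pdDer_mean, ← dV_apply, ha, map_zero]
  rw [D_eq_add_sum, D_eq_add_sum, Finset.sum_subset hsupp]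
  · simp [pdDer_mean, mean_coord_mul]
  · intro a _ ha
    rw [Finsupp.notMem_support_iff.1 ha, mul_zero]

theorem integ_LD (i : Fin 3) (θ : VForm) : integ (LD i θ) = D i (integ θ) := by
  induction θ using Finsupp.induction_linear with
  | zero => simp
  | add θ θ' h h' => simp only [map_add, h, h']
  | single a r =>
    rw [LD_single, map_add, integ_single, integ_single, integ_single, Derivation.leibniz, D_mean,
      vf_coord, spaceField_inr, smul_eq_mul, smul_eq_mul]
    ring

theorem D_base (i : Fin 3) (f : SmoothCyl Coord) : D i (base f) = base (D i f) := by
  rw [base, base, map_sub, ← integ_LD, LD_dV]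

theorem base_add_integ_dV (f : SmoothCyl Coord) : base f + integ (dV f) = f := sub_add_cancel ..

theorem D_anti (i : Fin 3) {f : SmoothCyl Coord} (hf : dV f = 0) :
    D i (anti (Sum.inl i.succ) f) = f := by
  rw [D_of_dV_eq_zero i (dV_anti _ hf), pdDer_anti_self]

theorem exists_eq_sum_D {f : SmoothCyl Coord} (h : ∀ s, euler s (dV f) = 0) :
    ∃ a : Fin 3 → SmoothCyl Coord, f = ∑ i, D i (a i) := by
  obtain ⟨θ, hθ⟩ := sub_sum_single_euler_mem_range_divV (dV f)
  simp only [h, Finsupp.single_zero, Finset.sum_const_zero, sub_zero, divV_apply] at hθ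
  refine ⟨fun i => integ (θ i) + if i = 0 then anti (Sum.inl 1) (base f) else 0, ?_⟩
  have hbase : D 0 (anti (Sum.inl 1) (base f)) = base f := D_anti 0 (dV_base f)
  simp only [map_add, Finset.sum_add_distrib, ← integ_LD, ← map_sum, hθ, apply_ite (D _), map_zero]
  rw [Finset.sum_ite_eq' Finset.univ (0 : Fin 3), if_pos (Finset.mem_univ _), hbase, add_comm,
    base_add_integ_dV]

theorem exists_curl_of_div_eq_zero_of_dV_eq_zero {a b c : SmoothCyl Coord} (ha : dV a = 0)
    (hb : dV b = 0) (hc : dV c = 0) (h : D 0 a + D 1 b + D 2 c = 0) :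
    ∃ l m n, a = -D 1 l - D 2 m ∧ b = D 0 l - D 2 n ∧ c = D 0 m + D 1 n := by
  let l := anti (Sum.inl 1) b
  let m := anti (Sum.inl 1) c
  have hl : D 0 l = b := D_anti 0 hb
  have hm : D 0 m = c := D_anti 0 hc
  let r := a + D 1 l + D 2 m
  have hdVr : dV r = 0 := by
    rw [map_add, map_add, ha, dV_D_eq_zero 1 (dV_anti 1 hb),
      dV_D_eq_zero 2 (dV_anti 1 hc), add_zero, add_zero]
  have hr : D 0 r = 0 := by
    rw [map_add, map_add, D_comm 0 1, D_comm 0 2, hl, hm, h]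
  let q := anti (Sum.inl 2) r
  have hq1 : D 1 q = r := D_anti 1 hdVr
  have hq0 : D 0 q = 0 := by
    rw [D_of_dV_eq_zero 0 hdVr] at hr
    rw [D_of_dV_eq_zero 0 (dV_anti 2 hdVr), pdDer_anti_of_ne (by simp), hr, map_zero]
  refine ⟨l - q, m, 0, ?_, ?_, ?_⟩
  · rw [map_sub, hq1]; ring
  · rw [map_sub, hl, hq0, map_zero, sub_zero, sub_zero]
  · rw [hm, map_zero, add_zero]

theorem exists_curl_of_div_eq_zero {a b c : SmoothCyl Coord} (h : D 0 a + D 1 b + D 2 c = 0) :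
    ∃ l m n, a = -D 1 l - D 2 m ∧ b = D 0 l - D 2 n ∧ c = D 0 m + D 1 n := by
  obtain ⟨l, m, n, ha, hb, hc⟩ := exists_curl_of_div_eq_zero_vForm
    (a := dV a) (b := dV b) (c := dV c) (by
      rw [LD_dV, LD_dV, LD_dV, ← map_add, ← map_add, h, map_zero])
  obtain ⟨l', m', n', ha', hb', hc'⟩ := exists_curl_of_div_eq_zero_of_dV_eq_zero
    (dV_base a) (dV_base b) (dV_base c) (by
      ext p
      have := DFunLike.congr_fun h (Sum.elim (fun j => p (Sum.inl j)) 0)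
      simpa [D_base, base_apply] using this)
  refine ⟨l' + integ l, m' + integ m, n' + integ n, ?_, ?_, ?_⟩
  · rw [← base_add_integ_dV a, ha, ha']
    simp only [map_sub, map_neg, map_add, integ_LD]
    ring
  · rw [← base_add_integ_dV b, hb, hb']
    simp only [map_sub, map_add, integ_LD]
    ring
  · rw [← base_add_integ_dV c, hc, hc']
    simp only [map_add, integ_LD]
    ring

/-! ### Cosymmetries -/

theorem dV_jetFn (s : Fin 2) (a b c : ℕ) :
    dV (jetFn s a b c) = Finsupp.single (s, ![a, b, c]) 1 :=
  dV_coord_inr _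

theorem D_zero_jetFn (s : Fin 2) (a b c : ℕ) : D 0 (jetFn s a b c) = jetFn s (a + 1) b c := by
  rw [jetFn, vf_coord, spaceField_inr, jetFn]
  congr 3
  funext i
  fin_cases i <;> simp

theorem D_one_jetFn (s : Fin 2) (a b c : ℕ) : D 1 (jetFn s a b c) = jetFn s a (b + 1) c := by
  rw [jetFn, vf_coord, spaceField_inr, jetFn]
  congr 3
  funext i
  fin_cases i <;> simp

theorem dV_rhsFn (μ : ℝ) : dV (rhsFn μ) =
    Finsupp.single (0, ![1, 0, 1]) 2 + Finsupp.single (0, ![2, 0, 0]) (jetFn 0 1 0 0) +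
      Finsupp.single (0, ![1, 0, 0]) (jetFn 0 2 0 0) - Finsupp.single (0, ![0, 2, 0]) 1 -
      μ • Finsupp.single (0, ![3, 0, 0]) 1 := by
  have h2 : dV (2 : SmoothCyl Coord) = 0 := dV.map_natCast 2
  simp only [rhsFn, map_sub, map_add, Derivation.leibniz, Derivation.map_smul, dV_jetFn, h2,
    smul_zero, add_zero, Finsupp.smul_single, smul_eq_mul, mul_one]
  abel

theorem euler_zero_smul_dV_rhsFn (μ : ℝ) (ψ : SmoothCyl Coord) : euler 0 (ψ • dV (rhsFn μ)) =
    2 * D 0 (D 2 ψ) + jetFn 0 1 0 0 * D 0 (D 0 ψ) + jetFn 0 2 0 0 * D 0 ψ - D 1 (D 1 ψ) +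
      μ • D 0 (D 0 (D 0 ψ)) := by
  have h2 (i : Fin 3) : D i (2 : SmoothCyl Coord) = 0 := (D i).map_natCast 2
  have h101 (g : SmoothCyl Coord) : adjDI ![1, 0, 1] g = D 0 (D 2 g) := by
    simp [adjDI, DI, Fin.sum_univ_three]
  have h200 (g : SmoothCyl Coord) : adjDI ![2, 0, 0] g = D 0 (D 0 g) := by
    simp [adjDI, DI, Fin.sum_univ_three, pow_two]
  have h100 (g : SmoothCyl Coord) : adjDI ![1, 0, 0] g = -D 0 g := by
    simp [adjDI, DI, Fin.sum_univ_three]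
  have h020 (g : SmoothCyl Coord) : adjDI ![0, 2, 0] g = D 1 (D 1 g) := by
    simp [adjDI, DI, Fin.sum_univ_three, pow_two]
  have h300 (g : SmoothCyl Coord) : adjDI ![3, 0, 0] g = -D 0 (D 0 (D 0 g)) := by
    simp [adjDI, DI, Fin.sum_univ_three, pow_succ]
  rw [dV_rhsFn]
  simp only [smul_sub, smul_add, smul_comm ψ μ, map_sub, map_add, map_smul]
  simp only [Finsupp.smul_single, euler_single, smul_eq_mul, if_true, mul_one, h101, h200, h100,
    h020, h300, Derivation.leibniz, map_add, D_zero_jetFn, h2, mul_zero, map_zero, add_zero]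
  simp only [Nat.reduceAdd, smul_neg]
  ring

theorem euler_one_smul_dV_rhsFn (μ : ℝ) (ψ : SmoothCyl Coord) :
    euler 1 (ψ • dV (rhsFn μ)) = 0 := by
  rw [dV_rhsFn]
  simp only [smul_sub, smul_add, smul_comm ψ μ, map_sub, map_add, map_smul]
  simp [-Finsupp.single_mul, Finsupp.smul_single, euler_single]

theorem euler_LDy_eq_zero_of_mem_range_divV (μ : ℝ) (s : Fin 2) {θ : VForm}
    (h : θ ∈ LinearMap.range divV) : euler s (LDy μ θ) = 0 := by
  obtain ⟨θ', rfl⟩ := h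
  rw [divV_apply, map_sum, map_sum]
  exact Finset.sum_eq_zero fun i _ => by rw [LDy_LD, euler_LD]

theorem euler_LDy (μ : ℝ) (s : Fin 2) (θ : VForm) : euler s (LDy μ θ) =
    euler s (Finsupp.single (0, 0) (Dy μ (euler 0 θ)) +
      Finsupp.single (1, 0) (euler 0 θ + Dy μ (euler 1 θ)) + euler 1 θ • dV (rhsFn μ)) := by
  have h := euler_LDy_eq_zero_of_mem_range_divV μ s (sub_sum_single_euler_mem_range_divV θ)
  rw [map_sub, map_sub, sub_eq_zero] at h
  rw [h, Fin.sum_univ_two, map_add, LDy_single_zero, LDy_single_one, DI_zero,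
    Module.End.one_apply, Finsupp.single_add]
  simp only [add_assoc]

theorem euler_one_LDy (μ : ℝ) (θ : VForm) :
    euler 1 (LDy μ θ) = euler 0 θ + Dy μ (euler 1 θ) := by
  simp [euler_LDy, euler_single, adjDI_zero, euler_one_smul_dV_rhsFn]

theorem euler_zero_LDy (μ : ℝ) (θ : VForm) :
    euler 0 (LDy μ θ) = Dy μ (euler 0 θ) + euler 0 (euler 1 θ • dV (rhsFn μ)) := by
  simp [euler_LDy, euler_single, adjDI_zero]

/-- Cosymmetries: the solutions of the formal adjoint of the linearized equation. -/
def IsCosymmetry (μ : ℝ) (ψ : SmoothCyl Coord) : Prop :=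
  Dy μ (Dy μ ψ) = euler 0 (ψ • dV (rhsFn μ))

/-! ### Weights -/

/-- The weight of a jet coordinate. Differentiation in `x`, `z`, `t` counts `2` and
differentiation in `y` counts `3`, so that `v_xxx` has the weight of `v_yy`. -/
def weight (a : Jet) : ℕ := 2 * ∑ i, a.2 i + 3 * a.1

theorem weight_add_single (s : Fin 2) (I : Fin 3 → ℕ) (i : Fin 3) :
    weight (s, I + Pi.single i 1) = weight (s, I) + 2 := by
  rw [weight, sum_add_single, weight]
  ring

theorem weight_zero (I : Fin 3 → ℕ) : weight (0, I) = 2 * ∑ i, I i := by simp [weight]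

theorem weight_one (I : Fin 3 → ℕ) : weight (1, I) = 2 * ∑ i, I i + 3 := by simp [weight]

/-- The vertical forms of weight less than `n`. -/
noncomputable def weightLT (n : ℕ) : Submodule (SmoothCyl Coord) VForm :=
  Finsupp.supported _ _ {a | weight a < n}

theorem mem_weightLT {n : ℕ} {θ : VForm} : θ ∈ weightLT n ↔ ∀ a, n ≤ weight a → θ a = 0 := by
  rw [weightLT, Finsupp.mem_supported']
  simp

theorem weightLT_mono {m n : ℕ} (h : m ≤ n) : weightLT m ≤ weightLT n :=
  Finsupp.supported_mono fun _ ha => ha.trans_le h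

theorem single_mem_weightLT {n : ℕ} {a : Jet} (h : weight a < n) (g : SmoothCyl Coord) :
    Finsupp.single a g ∈ weightLT n :=
  Finsupp.single_mem_supported _ g h

theorem map_mem_of_mem_weightLT {n : ℕ} {N : Submodule (SmoothCyl Coord) VForm}
    {φ : VForm →ₗ[ℝ] VForm} (h : ∀ a, weight a < n → ∀ g, φ (Finsupp.single a g) ∈ N) {θ : VForm}
    (hθ : θ ∈ weightLT n) : φ θ ∈ N :=
  map_mem_of_support_subset (s := {a | weight a < n}) h ((Finsupp.mem_supported _ θ).1 hθ)

/-- The symbol of the total derivative in `x`: it sends `g dv_I` to `g dv_(I + x)`. -/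
noncomputable def shift : Module.End (SmoothCyl Coord) VForm :=
  Finsupp.lmapDomain _ _ fun a => (a.1, a.2 + Pi.single 0 1)

theorem shift_single (a : Jet) (g : SmoothCyl Coord) :
    shift (Finsupp.single a g) = Finsupp.single (a.1, a.2 + Pi.single 0 1) g :=
  Finsupp.mapDomain_single

theorem shift_apply (θ : VForm) (s : Fin 2) (I : Fin 3 → ℕ) :
    shift θ (s, I + Pi.single 0 1) = θ (s, I) :=
  Finsupp.mapDomain_apply (f := fun a : Jet => (a.1, a.2 + Pi.single 0 1))
    (fun a b h => by simpa [Prod.ext_iff] using h) θ (s, I)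

theorem shift_pow_three (θ : VForm) : (shift ^ 3) θ = shift (shift (shift θ)) := by
  simp only [pow_succ, pow_zero, one_mul, Module.End.mul_apply]

theorem LD_shift (i : Fin 3) (θ : VForm) : LD i (shift θ) = shift (LD i θ) := by
  induction θ using Finsupp.induction_linear with
  | zero => simp
  | add θ θ' h h' => simp only [map_add, h, h']
  | single a g =>
    simp only [shift_single, LD_single, map_add]
    rw [add_right_comm a.2]

theorem shift_mem_weightLT {n : ℕ} {θ : VForm} (hθ : θ ∈ weightLT n) :
    shift θ ∈ weightLT (n + 2) := by
  refine map_mem_of_mem_weightLT (φ := shift.restrictScalars ℝ) (fun a ha g => ?_) hθ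
  rw [LinearMap.restrictScalars_apply, shift_single]
  exact single_mem_weightLT (by rw [weight_add_single]; exact Nat.add_lt_add_right ha 2) g

theorem shift_pow_three_mem_weightLT {n : ℕ} {θ : VForm} (hθ : θ ∈ weightLT n) :
    (shift ^ 3) θ ∈ weightLT (n + 6) := by
  rw [shift_pow_three]
  exact shift_mem_weightLT (shift_mem_weightLT (shift_mem_weightLT hθ))

theorem LD_mem_weightLT (i : Fin 3) {n : ℕ} {θ : VForm} (hθ : θ ∈ weightLT n) :
    LD i θ ∈ weightLT (n + 2) := by
  refine map_mem_of_mem_weightLT (fun a ha g => ?_) hθ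
  rw [LD_single]
  exact add_mem (single_mem_weightLT (by omega) _)
    (single_mem_weightLT (by rw [weight_add_single]; exact Nat.add_lt_add_right ha 2) _)

theorem LD_zero_sub_shift_mem {n : ℕ} {θ : VForm} (hθ : θ ∈ weightLT n) :
    LD 0 θ - shift θ ∈ weightLT n := by
  refine map_mem_of_mem_weightLT (φ := LD 0 - shift.restrictScalars ℝ) (fun a ha g => ?_) hθ
  rw [LinearMap.sub_apply, LinearMap.restrictScalars_apply, shift_single, LD_single,
    add_sub_cancel_right]
  exact single_mem_weightLT ha _

theorem LD_zero_cubed_sub_shift_cubed_mem {n : ℕ} {θ : VForm} (hθ : θ ∈ weightLT n) :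
    LD 0 (LD 0 (LD 0 θ)) - (shift ^ 3) θ ∈ weightLT (n + 4) := by
  have h1 := LD_mem_weightLT 0 (LD_mem_weightLT 0 (LD_zero_sub_shift_mem hθ))
  have h2 := LD_mem_weightLT 0 (LD_zero_sub_shift_mem (shift_mem_weightLT hθ))
  have h3 := LD_zero_sub_shift_mem (shift_mem_weightLT (shift_mem_weightLT hθ))
  convert add_mem (add_mem h1 h2) h3 using 1
  simp only [map_sub, shift_pow_three]
  abel

theorem dV_DI_rhsFn_add_mem (μ : ℝ) (I : Fin 3 → ℕ) :
    dV (DI I (rhsFn μ)) + μ • (shift ^ 3) (Finsupp.single (0, I) 1) ∈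
      weightLT (weight (0, I) + 6) := by
  induction I using multiIndex_induction with
  | zero =>
    have h3 : (shift ^ 3) (Finsupp.single (0, 0) 1) = Finsupp.single (0, ![3, 0, 0]) 1 := by
      simp only [shift_pow_three, shift_single]
      congr 2
      funext i
      fin_cases i <;> simp
    have hsingle (J : Fin 3 → ℕ) (hJ : ∑ i, J i ≤ 2) (g : SmoothCyl Coord) :
        Finsupp.single ((0, J) : Jet) g ∈ weightLT (weight (0, 0) + 6) :=
      single_mem_weightLT (by rw [weight_zero]; omega) g
    rw [DI_zero, Module.End.one_apply, h3, dV_rhsFn, sub_add_cancel]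
    exact sub_mem (add_mem (add_mem (hsingle _ (by simp [Fin.sum_univ_three]) _)
      (hsingle _ (by simp [Fin.sum_univ_three]) _)) (hsingle _ (by simp [Fin.sum_univ_three]) _))
      (hsingle _ (by simp [Fin.sum_univ_three]) _)
  | add_single I i ih =>
    have hLD : LD i (Finsupp.single ((0, I) : Jet) 1) =
        Finsupp.single (0, I + Pi.single i 1) 1 := by
      rw [LD_single, Derivation.map_one_eq_zero, Finsupp.single_zero, zero_add]
    have := LD_mem_weightLT i ih
    rw [shift_pow_three] at this ⊢
    rw [map_add, LD_dV, D_DI, map_smul, LD_shift, LD_shift, LD_shift, hLD] at this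
    rwa [weight_add_single, add_right_comm]

theorem LDy_single_one_mem (μ : ℝ) (a : Jet) :
    LDy μ (Finsupp.single a 1) ∈ weightLT (weight a + 4) := by
  obtain ⟨s, I⟩ := a
  obtain rfl | rfl : s = 0 ∨ s = 1 := by omega
  · rw [LDy_single_zero, Derivation.map_one_eq_zero, Finsupp.single_zero, zero_add]
    exact single_mem_weightLT (by rw [weight_zero, weight_one]; omega) 1
  · have hlead : (shift ^ 3) (Finsupp.single (0, I) 1) ∈ weightLT (weight (0, I) + 1 + 6) :=
      shift_pow_three_mem_weightLT (single_mem_weightLT (Nat.lt_succ_self _) 1)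
    have h := sub_mem (weightLT_mono (Nat.le_succ _) (dV_DI_rhsFn_add_mem μ I))
      (Submodule.smul_of_tower_mem _ μ hlead)
    rw [LDy_single_one, Derivation.map_one_eq_zero, Finsupp.single_zero, zero_add, one_smul]
    rw [add_sub_cancel_right, weight_zero] at h
    rwa [weight_one]

theorem LDy_mem_weightLT (μ : ℝ) {n : ℕ} {θ : VForm} (hθ : θ ∈ weightLT n) :
    LDy μ θ ∈ weightLT (n + 3) := by
  refine map_mem_of_mem_weightLT (fun a ha g => ?_) hθ
  rw [← Finsupp.smul_single_one, lie_smul]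
  exact add_mem (Submodule.smul_mem _ _ (single_mem_weightLT (by omega) 1))
    (Submodule.smul_mem _ _ (weightLT_mono (by omega) (LDy_single_one_mem μ a)))

theorem LDy_shift_single (μ : ℝ) (I : Fin 3 → ℕ) :
    LDy μ ((shift ^ 3) (Finsupp.single (0, I) 1)) = (shift ^ 3) (Finsupp.single (1, I) 1) := by
  simp only [shift_pow_three, shift_single]
  rw [LDy_single_zero, Derivation.map_one_eq_zero, Finsupp.single_zero, zero_add]

theorem LDy_LDy_single_one_add_mem (μ : ℝ) (a : Jet) :
    LDy μ (LDy μ (Finsupp.single a 1)) + μ • (shift ^ 3) (Finsupp.single a 1) ∈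
      weightLT (weight a + 6) := by
  have hzero (I : Fin 3 → ℕ) :
      LDy μ (LDy μ (Finsupp.single (0, I) 1)) = dV (DI I (rhsFn μ)) := by
    rw [← dV_coord_inr, LDy_dV, LDy_dV, vf_coord, evolField_zero, vf_coord, evolField_one]
  obtain ⟨s, I⟩ := a
  obtain rfl | rfl : s = 0 ∨ s = 1 := by omega
  · rw [hzero]
    exact dV_DI_rhsFn_add_mem μ I
  · have hone : LDy μ (LDy μ (Finsupp.single (1, I) 1)) = LDy μ (dV (DI I (rhsFn μ))) := by
      rw [← dV_coord_inr, LDy_dV, LDy_dV, LDy_dV, vf_coord, evolField_one]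
    have h := LDy_mem_weightLT μ (dV_DI_rhsFn_add_mem μ I)
    rw [map_add, map_smul, LDy_shift_single, ← hone] at h
    exact weightLT_mono (by rw [weight_zero, weight_one]) h

theorem LDy_LDy_add_shift_cubed_mem (μ : ℝ) {n : ℕ} {θ : VForm} (hθ : θ ∈ weightLT n) :
    LDy μ (LDy μ θ) + μ • (shift ^ 3) θ ∈ weightLT (n + 5) := by
  let φ : VForm →ₗ[ℝ] VForm := LDy μ ∘ₗ LDy μ + μ • (shift ^ 3).restrictScalars ℝ
  have hφ (ξ : VForm) : φ ξ = LDy μ (LDy μ ξ) + μ • (shift ^ 3) ξ := rfl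
  rw [← hφ]
  refine map_mem_of_mem_weightLT (fun a ha g => ?_) hθ
  have hsmul {m : ℕ} (hm : m ≤ n + 5) {ξ : VForm} (hξ : ξ ∈ weightLT m) (f : SmoothCyl Coord) :
      f • ξ ∈ weightLT (n + 5) := Submodule.smul_mem _ f (weightLT_mono hm hξ)
  have h0 := single_mem_weightLT (Nat.lt_succ_self (weight a)) 1
  have h1 := LDy_single_one_mem μ a
  have h2 := LDy_LDy_single_one_add_mem μ a
  convert add_mem (add_mem (hsmul (by omega) h0 (Dy μ (Dy μ g)))
    (hsmul (by omega) h1 (2 * Dy μ g))) (hsmul (by omega) h2 g) using 1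
  rw [hφ, ← Finsupp.smul_single_one, lie_smul, map_add, lie_smul,
    lie_smul, map_smul, smul_add g, smul_comm g μ, two_mul, add_smul]
  abel

theorem dV_euler_smul_dV_rhsFn_sub_mem (μ : ℝ) {ψ : SmoothCyl Coord} {n : ℕ}
    (h : dV ψ ∈ weightLT n) :
    dV (euler 0 (ψ • dV (rhsFn μ))) - μ • LD 0 (LD 0 (LD 0 (dV ψ))) ∈ weightLT (n + 5) := by
  have h2 : dV (2 : SmoothCyl Coord) = 0 := dV.map_natCast 2
  have hsmul {m : ℕ} (hm : m ≤ n + 5) {θ : VForm} (hθ : θ ∈ weightLT m) (g : SmoothCyl Coord) :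
      g • θ ∈ weightLT (n + 5) := Submodule.smul_mem _ g (weightLT_mono hm hθ)
  have hD (i : Fin 3) : dV (D i ψ) ∈ weightLT (n + 2) := LD_dV i ψ ▸ LD_mem_weightLT i h
  have hDD (i j : Fin 3) : dV (D i (D j ψ)) ∈ weightLT (n + 4) :=
    LD_dV i (D j ψ) ▸ LD_mem_weightLT i (hD j)
  have hjet (k : ℕ) (hk : k ≤ 2) : dV (jetFn 0 k 0 0) ∈ weightLT 5 := by
    rw [dV_jetFn]
    exact single_mem_weightLT (by simp [weight_zero, Fin.sum_univ_three]; omega) 1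
  rw [euler_zero_smul_dV_rhsFn]
  simp only [LD_dV, map_add, map_sub, Derivation.map_smul, add_sub_cancel_right,
    Derivation.leibniz, h2, smul_zero, add_zero]
  exact sub_mem (add_mem (add_mem (hsmul (by omega) (hDD 0 2) _)
    (add_mem (hsmul (by omega) (hDD 0 0) _) (hsmul (by omega) (hjet 1 one_le_two) _)))
    (add_mem (hsmul (by omega) (hD 0) _) (hsmul (by omega) (hjet 2 le_rfl) _)))
    (weightLT_mono (by omega) (hDD 1 1))

namespace IsCosymmetry

variable {μ : ℝ} {ψ : SmoothCyl Coord}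

/-- The leading parts of both sides of the cosymmetry equation are opposite, hence vanish. -/
theorem shift_cubed_dV_mem (h : IsCosymmetry μ ψ) (hμ : μ ≠ 0) {n : ℕ} (hn : dV ψ ∈ weightLT n) :
    (shift ^ 3) (dV ψ) ∈ weightLT (n + 5) := by
  have hleft := LDy_LDy_add_shift_cubed_mem μ hn
  have hright := dV_euler_smul_dV_rhsFn_sub_mem μ hn
  have hLD := Submodule.smul_of_tower_mem _ μ
    (weightLT_mono (Nat.le_succ _) (LD_zero_cubed_sub_shift_cubed_mem hn))
  rw [LDy_dV, LDy_dV, h] at hleft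
  have hsum : (2 * μ) • (shift ^ 3) (dV ψ) ∈ weightLT (n + 5) := by
    convert sub_mem hleft (add_mem hright hLD) using 1
    rw [two_mul, add_smul, smul_sub]
    abel
  have := Submodule.smul_of_tower_mem _ (2 * μ)⁻¹ hsum
  rwa [inv_smul_smul₀ (mul_ne_zero two_ne_zero hμ)] at this

theorem dV_eq_zero (h : IsCosymmetry μ ψ) (hμ : μ ≠ 0) : dV ψ = 0 := by
  by_contra hψ
  obtain ⟨a, ha, hmax⟩ := (dV ψ).support.exists_max_image weight
    (Finsupp.support_nonempty_iff.2 hψ)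
  have hmem : dV ψ ∈ weightLT (weight a + 1) := mem_weightLT.2 fun b hb => by
    by_contra hne
    exact absurd (hmax b (Finsupp.mem_support_iff.2 hne)) (by omega)
  have hzero := mem_weightLT.1 (h.shift_cubed_dV_mem hμ hmem)
    (a.1, a.2 + Pi.single 0 1 + Pi.single 0 1 + Pi.single 0 1) (by
      rw [weight_add_single, weight_add_single, weight_add_single])
  rw [shift_pow_three, shift_apply, shift_apply, shift_apply] at hzero
  exact Finsupp.mem_support_iff.1 ha hzero

theorem D_zero_eq_zero (h : IsCosymmetry μ ψ) (hμ : μ ≠ 0) : D 0 ψ = 0 := by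
  have hV := h.dV_eq_zero hμ
  have h2 : dV (2 : SmoothCyl Coord) = 0 := dV.map_natCast 2
  have hD (i : Fin 3) := dV_D_eq_zero i hV
  have hDD (i j : Fin 3) := dV_D_eq_zero i (hD j)
  have hdV := congrArg dV h
  simp only [euler_zero_smul_dV_rhsFn, map_add, map_sub, Derivation.map_smul, Derivation.leibniz,
    h2, hD, hDD, dV_D_eq_zero 0 (hDD 0 0), dV_Dy_eq_zero μ (dV_Dy_eq_zero μ hV), smul_zero,
    add_zero, zero_add, sub_zero, dV_jetFn, Finsupp.smul_single, smul_eq_mul, mul_one] at hdV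
  -- the coefficient of `dv_xx`
  simpa using (DFunLike.congr_fun hdV (0, ![2, 0, 0])).symm

theorem laplace_eq_zero (h : IsCosymmetry μ ψ) (hμ : μ ≠ 0) :
    Dy μ (Dy μ ψ) + D 1 (D 1 ψ) = 0 := by
  rw [h, euler_zero_smul_dV_rhsFn, D_comm 0 2, h.D_zero_eq_zero hμ]
  simp

end IsCosymmetry

/-! ### Currents and their characteristics -/

/-- The total derivatives on the equation, in the order `y`, `x`, `z`, `t`: `totalD` on the algebra
of smooth functions. -/
noncomputable def totalDer (μ : ℝ) : Fin 4 → Derivation ℝ (SmoothCyl Coord) (SmoothCyl Coord) :=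
  Fin.cases (Dy μ) D

theorem coe_totalDer (μ : ℝ) (k : Fin 4) (f : SmoothCyl Coord) :
    ⇑(totalDer μ k f) = totalD μ k f := by
  induction k using Fin.cases with
  | zero => exact coe_Dy μ f
  | succ i => exact coe_D i f

/-- The total divergence of a current on the equation. -/
noncomputable def totalDiv (μ : ℝ) : (Fin 4 → SmoothCyl Coord) →ₗ[ℝ] SmoothCyl Coord :=
  LinearMap.lsum ℝ (fun _ => SmoothCyl Coord) ℝ fun k => (totalDer μ k).toLinearMap

theorem totalDiv_apply (μ : ℝ) (J : Fin 4 → SmoothCyl Coord) :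
    totalDiv μ J = Dy μ (J 0) + ∑ i, D i (J i.succ) := by
  rw [totalDiv, LinearMap.lsum_apply, LinearMap.sum_apply, Fin.sum_univ_succ]
  rfl

theorem isConservedCurrent_iff (μ : ℝ) (J : Fin 4 → SmoothCyl Coord) :
    IsConservedCurrent μ (fun k => J k) ↔ totalDiv μ J = 0 := by
  have hdiv (p : Pt) : ∑ k, totalD μ k (J k) p = totalDiv μ J p := by
    simp [totalDiv, coe_totalDer]
  simp only [IsConservedCurrent, hdiv]
  exact ⟨fun h => ext h.2, fun h => ⟨fun k => (J k).isSmoothCyl, DFunLike.congr_fun h⟩⟩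

/-- The characteristic of a current, as an element of the algebra of smooth functions. -/
noncomputable def charFn (J : Fin 4 → SmoothCyl Coord) : SmoothCyl Coord := euler 1 (dV (J 0))

theorem euler_eq_sum (s : Fin 2) (θ : VForm) :
    euler s θ = ∑ I ∈ θ.support.image Prod.snd, adjDI I (θ (s, I)) := by
  have hsupp : θ.support ⊆ Finset.univ ×ˢ θ.support.image Prod.snd := fun a ha =>
    Finset.mem_product.2 ⟨Finset.mem_univ _, Finset.mem_image_of_mem _ ha⟩
  rw [euler, Finsupp.lsum_apply, Finsupp.sum_of_support_subset _ hsupp _ (fun _ _ => map_zero _),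
    Finset.sum_product, Finset.sum_eq_single s]
  · simp
  · intro r _ hr
    simp [hr]
  · simp

theorem characteristic_eq (J : Fin 4 → SmoothCyl Coord) :
    characteristic (fun k => J k) = charFn J := by
  funext p
  have hterm (I : Fin 3 → ℕ) : (-1) ^ (∑ i, I i) * spaceDIter I (pd (Sum.inr (1, I)) (J 0)) p =
      adjDI I (dV (J 0) (1, I)) p := by
    rw [← coe_pdDer, ← coe_DI]
    rfl
  rw [charFn, euler_eq_sum, sum_apply, characteristic]
  simp only [hterm]
  refine finsum_eq_sum_of_support_subset _ fun I hI => ?_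
  refine Finset.mem_coe.2 (Finset.mem_image.2 ⟨(1, I), Finsupp.mem_support_iff.2 fun h => ?_, rfl⟩)
  exact hI (by dsimp only; rw [h, map_zero, zero_apply])

theorem euler_LDy_dV_eq_zero {μ : ℝ} {J : Fin 4 → SmoothCyl Coord} (h : totalDiv μ J = 0)
    (s : Fin 2) : euler s (LDy μ (dV (J 0))) = 0 := by
  have := congrArg (fun f => euler s (dV f)) h
  simpa only [totalDiv_apply, map_add, map_sum, ← LDy_dV, ← LD_dV, euler_LD,
    Finset.sum_const_zero, add_zero, map_zero] using this

theorem euler_zero_dV_eq {μ : ℝ} {J : Fin 4 → SmoothCyl Coord} (h : totalDiv μ J = 0) :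
    euler 0 (dV (J 0)) = -Dy μ (charFn J) :=
  eq_neg_of_add_eq_zero_left ((euler_one_LDy μ _).symm.trans (euler_LDy_dV_eq_zero h 1))

theorem isCosymmetry_charFn {μ : ℝ} {J : Fin 4 → SmoothCyl Coord} (h : totalDiv μ J = 0) :
    IsCosymmetry μ (charFn J) := by
  have h0 := (euler_zero_LDy μ _).symm.trans (euler_LDy_dV_eq_zero h 0)
  rwa [euler_zero_dV_eq h, map_neg, neg_add_eq_zero] at h0

/-! ### Currents with vanishing characteristic -/

theorem exists_potential {μ : ℝ} {J : Fin 4 → SmoothCyl Coord} (h : totalDiv μ J = 0)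
    (hJ : charFn J = 0) :
    ∃ (a : Fin 3 → SmoothCyl Coord) (l m n : SmoothCyl Coord), J 0 = ∑ i, D i (a i) ∧
      J 1 = -Dy μ (a 0) - D 1 l - D 2 m ∧ J 2 = -Dy μ (a 1) + D 0 l - D 2 n ∧
      J 3 = -Dy μ (a 2) + D 0 m + D 1 n := by
  obtain ⟨a, ha⟩ := exists_eq_sum_D (f := J 0) <| Fin.forall_fin_two.2
    ⟨by rw [euler_zero_dV_eq h, hJ, map_zero, neg_zero], hJ⟩
  obtain ⟨l, m, n, h1, h2, h3⟩ := exists_curl_of_div_eq_zero (a := J 1 + Dy μ (a 0))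
    (b := J 2 + Dy μ (a 1)) (c := J 3 + Dy μ (a 2)) (by
      rw [← h, totalDiv_apply, ha, Fin.sum_univ_three, Fin.sum_univ_three]
      simp only [map_add, Dy_D]
      change _ = _ + (D 0 (J 1) + D 1 (J 2) + D 2 (J 3))
      ring)
  refine ⟨a, l, m, n, ha, ?_, ?_, ?_⟩
  · rw [eq_sub_of_add_eq h1]; ring
  · rw [eq_sub_of_add_eq h2]; ring
  · rw [eq_sub_of_add_eq h3]; ring

theorem isTrivialCurrent_of_charFn_eq_zero {μ : ℝ} {J : Fin 4 → SmoothCyl Coord}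
    (h : totalDiv μ J = 0) (hJ : charFn J = 0) : IsTrivialCurrent μ (fun k => J k) := by
  obtain ⟨a, l, m, n, h0, h1, h2, h3⟩ := exists_potential h hJ
  let L : Fin 4 → Fin 4 → SmoothCyl Coord :=
    ![![0, -a 0, -a 1, -a 2], ![0, 0, l, m], ![0, 0, 0, n], 0]
  refine ⟨fun k j => L k j, fun k j _ => (L k j).isSmoothCyl, fun k p => ?_⟩
  have hy : totalDer μ 0 = Dy μ := rfl
  have hx : totalDer μ 1 = D 0 := rfl
  have hz : totalDer μ 2 = D 1 := rfl
  have ht : totalDer μ 3 = D 2 := rfl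
  simp only [Finset.sum_filter, Fin.sum_univ_four, ← coe_totalDer, hy, hx, hz, ht]
  fin_cases k
  · simp [L, h0, Fin.sum_univ_three]
    ring
  · simp [L, h1]
    ring
  · simp [L, h2]
  · simp [L, h3]

/-! ### The explicit currents -/

/-- The current `(*)` of the theorem: `explicitCurrent` with `χ` replaced by an arbitrary
element `ψ` of the algebra of smooth functions. -/
noncomputable def explicitFn (μ : ℝ) (ψ : SmoothCyl Coord) : Fin 4 → SmoothCyl Coord :=
  ![ψ * jetFn 1 0 0 0 - Dy μ ψ * jetFn 0 0 0 0,
    μ • (ψ * jetFn 0 2 0 0) - (1 / 2 : ℝ) • (ψ * jetFn 0 1 0 0 ^ 2) - 2 * ψ * jetFn 0 0 0 1,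
    ψ * jetFn 0 0 1 0 - D 1 ψ * jetFn 0 0 0 0,
    0]

theorem jetFn_zero (s : Fin 2) : jetFn s 0 0 0 = coord (Sum.inr (s, 0)) := by
  rw [jetFn, show (![0, 0, 0] : Fin 3 → ℕ) = 0 by simp]

theorem Dy_jetFn_zero (μ : ℝ) : Dy μ (jetFn 0 0 0 0) = jetFn 1 0 0 0 := by
  rw [jetFn_zero, vf_coord, evolField_zero, jetFn_zero]

theorem Dy_jetFn_one (μ : ℝ) : Dy μ (jetFn 1 0 0 0) = rhsFn μ := by
  rw [jetFn_zero, vf_coord, evolField_one, DI_zero, Module.End.one_apply]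

theorem Dy_explicitFn_zero (μ : ℝ) (ψ : SmoothCyl Coord) :
    Dy μ (explicitFn μ ψ 0) = ψ * rhsFn μ - Dy μ (Dy μ ψ) * jetFn 0 0 0 0 := by
  simp only [explicitFn, Matrix.cons_val_zero, map_sub, Derivation.leibniz, Dy_jetFn_zero,
    Dy_jetFn_one, smul_eq_mul]
  ring

theorem D_zero_explicitFn_one (μ : ℝ) {ψ : SmoothCyl Coord} (h : D 0 ψ = 0) :
    D 0 (explicitFn μ ψ 1) = ψ * (μ • jetFn 0 3 0 0 - jetFn 0 1 0 0 * jetFn 0 2 0 0 -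
      2 * jetFn 0 1 0 1) := by
  have h2 : D 0 (2 : SmoothCyl Coord) = 0 := (D 0).map_natCast 2
  simp only [explicitFn, Matrix.cons_val_one, Matrix.cons_val_zero, map_sub, Derivation.leibniz,
    Derivation.map_smul, D_zero_jetFn, h, h2, pow_two, smul_eq_mul]
  ext p
  simp
  ring

theorem D_one_explicitFn_two (μ : ℝ) (ψ : SmoothCyl Coord) :
    D 1 (explicitFn μ ψ 2) = ψ * jetFn 0 0 2 0 - D 1 (D 1 ψ) * jetFn 0 0 0 0 := by
  simp only [explicitFn, Matrix.cons_val, map_sub, Derivation.leibniz, D_one_jetFn, smul_eq_mul]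
  ring

theorem totalDiv_explicitFn (μ : ℝ) {ψ : SmoothCyl Coord} (h0 : D 0 ψ = 0)
    (h : Dy μ (Dy μ ψ) + D 1 (D 1 ψ) = 0) : totalDiv μ (explicitFn μ ψ) = 0 := by
  have h3 : D 2 (explicitFn μ ψ 3) = 0 := map_zero _
  rw [totalDiv_apply, Fin.sum_univ_three]
  change _ + (D 0 (explicitFn μ ψ 1) + D 1 (explicitFn μ ψ 2) + D 2 (explicitFn μ ψ 3)) = 0
  rw [Dy_explicitFn_zero, D_zero_explicitFn_one μ h0, D_one_explicitFn_two, h3, rhsFn,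
    eq_neg_of_add_eq_zero_left h]
  ring

theorem charFn_explicitFn (μ : ℝ) {ψ : SmoothCyl Coord} (hψ : dV ψ = 0) :
    charFn (explicitFn μ ψ) = ψ := by
  simp [charFn, explicitFn, hψ, dV_Dy_eq_zero μ hψ, jetFn_zero, dV_coord_inr, euler_single,
    adjDI_zero]

theorem currentEquiv_explicitFn {μ : ℝ} {J : Fin 4 → SmoothCyl Coord}
    (hJ : totalDiv μ J = 0) (hV : dV (charFn J) = 0) (h0 : D 0 (charFn J) = 0)
    (h : Dy μ (Dy μ (charFn J)) + D 1 (D 1 (charFn J)) = 0) :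
    CurrentEquiv μ (fun k => J k) (fun k => explicitFn μ (charFn J) k) := by
  refine isTrivialCurrent_of_charFn_eq_zero (J := J - explicitFn μ (charFn J)) ?_ ?_
  · rw [map_sub, hJ, totalDiv_explicitFn μ h0 h, sub_zero]
  · rw [charFn, Pi.sub_apply, map_sub, map_sub]
    exact sub_eq_zero.2 (charFn_explicitFn μ hV).symm

/-! ### Functions of the independent variables -/

theorem pd_inl_lift (j : Fin 4) (χ : (Fin 4 → ℝ) → ℝ) :
    pd (Sum.inl j) (lift χ) = lift (pd j χ) := by
  funext p
  refine congrArg (fun F : ℝ → ℝ => deriv F (p (Sum.inl j))) (funext fun s => ?_)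
  exact congrArg χ (funext fun i => by simp [Function.update_apply])

theorem isSmooth_lift {χ : (Fin 4 → ℝ) → ℝ} (h : ContDiff ℝ ∞ χ) : IsSmooth (lift χ) :=
  ⟨Finset.univ.disjSum ∅, fun q => χ fun i => q ⟨Sum.inl i, by simp⟩,
    h.comp (by fun_prop), fun _ => rfl⟩

theorem lift_injective : Function.Injective lift := fun _ _ h =>
  funext fun q => congrFun h (Sum.elim q 0)

section Lift

variable {ψ : SmoothCyl Coord} {χ : (Fin 4 → ℝ) → ℝ}

theorem dV_eq_zero_of_coe_eq_lift (h : ⇑ψ = lift χ) : dV ψ = 0 := by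
  ext1 a
  exact pdDer_eq_zero_of_update fun p s => by simp [h, lift]

theorem coe_pdDer_of_coe_eq_lift (h : ⇑ψ = lift χ) (j : Fin 4) :
    ⇑(pdDer (Sum.inl j) ψ) = lift (pd j χ) := by
  rw [coe_pdDer, h, pd_inl_lift]

theorem coe_Dy_of_coe_eq_lift (μ : ℝ) (h : ⇑ψ = lift χ) : ⇑(Dy μ ψ) = lift (pd 0 χ) := by
  rw [Dy_of_dV_eq_zero μ (dV_eq_zero_of_coe_eq_lift h), coe_pdDer_of_coe_eq_lift h]

theorem coe_D_of_coe_eq_lift (i : Fin 3) (h : ⇑ψ = lift χ) : ⇑(D i ψ) = lift (pd i.succ χ) := by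
  rw [D_of_dV_eq_zero i (dV_eq_zero_of_coe_eq_lift h), coe_pdDer_of_coe_eq_lift h]

theorem exists_coe_eq_lift (h : dV ψ = 0) :
    ∃ χ : (Fin 4 → ℝ) → ℝ, ContDiff ℝ ∞ χ ∧ ⇑ψ = lift χ := by
  refine ⟨fun q => ψ (Sum.elim q 0), ψ.isSmoothCyl.contDiff_comp ?_, funext fun p => ?_⟩
  · rintro (j | _)
    · exact contDiff_apply ℝ ℝ j
    · exact contDiff_const
  · have := integ_dV ψ p
    rw [h, map_zero, zero_apply] at this
    exact (sub_eq_zero.1 this.symm)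

theorem isAdmissible_iff (μ : ℝ) (hχ : ContDiff ℝ ∞ χ) (h : ⇑ψ = lift χ) :
    IsAdmissible χ ↔ D 0 ψ = 0 ∧ Dy μ (Dy μ ψ) + D 1 (D 1 ψ) = 0 := by
  have hx : D 0 ψ = 0 ↔ pd 1 χ = 0 := by
    rw [← DFunLike.coe_fn_eq, coe_D_of_coe_eq_lift 0 h]
    exact lift_injective.eq_iff (b := 0)
  have hyz : Dy μ (Dy μ ψ) + D 1 (D 1 ψ) = 0 ↔ pd 0 (pd 0 χ) + pd 2 (pd 2 χ) = 0 := by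
    have hyy := coe_Dy_of_coe_eq_lift μ (coe_Dy_of_coe_eq_lift μ h)
    have hzz := coe_D_of_coe_eq_lift 1 (coe_D_of_coe_eq_lift 1 h)
    rw [← DFunLike.coe_fn_eq, ← lift_injective.eq_iff]
    change ⇑(Dy μ (Dy μ ψ)) + ⇑(D 1 (D 1 ψ)) = 0 ↔ _
    rw [hyy, hzz]
    rfl
  rw [hx, hyz, funext_iff, funext_iff]
  exact and_iff_right hχ

theorem coe_explicitFn (μ : ℝ) (h : ⇑ψ = lift χ) :
    (fun k => ⇑(explicitFn μ ψ k)) = explicitCurrent μ χ := by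
  have hjet (s : Fin 2) (a b c : ℕ) : ⇑(jetFn s a b c) = jet s a b c := rfl
  have h2 (p : Pt) : (2 : SmoothCyl Coord) p = 2 := rfl
  have hy := coe_Dy_of_coe_eq_lift μ h
  have hz := coe_D_of_coe_eq_lift 1 h
  funext k p
  fin_cases k
  · simp [explicitFn, explicitCurrent, h, hy, hjet]
  · simp [explicitFn, explicitCurrent, h, hjet, h2, pow_two]
    ring
  · simp [explicitFn, explicitCurrent, h, hz, hjet]
  · simp [explicitFn, explicitCurrent]

end Lift

end ViscousTransonic

theorem mainTheorem9 (μ : ℝ) (hμ : μ ≠ 0) :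
    (∀ J : Fin 4 → ViscousTransonic.Pt → ℝ, ViscousTransonic.IsConservedCurrent μ J →
      ∃ χ : (Fin 4 → ℝ) → ℝ, ViscousTransonic.IsAdmissible χ ∧
        ViscousTransonic.characteristic J = ViscousTransonic.lift χ ∧
        ViscousTransonic.CurrentEquiv μ J (ViscousTransonic.explicitCurrent μ χ)) ∧
    (∀ χ : (Fin 4 → ℝ) → ℝ, ViscousTransonic.IsAdmissible χ →
      ViscousTransonic.IsConservedCurrent μ (ViscousTransonic.explicitCurrent μ χ) ∧
        ViscousTransonic.characteristic (ViscousTransonic.explicitCurrent μ χ) =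
          ViscousTransonic.lift χ) := by
  open ViscousTransonic in
  constructor
  · intro J' hJ'
    obtain ⟨J, rfl⟩ : ∃ J : Fin 4 → SmoothCyl Coord, J' = fun k => ⇑(J k) :=
      ⟨fun k => .mk (J' k) (hJ'.1 k), rfl⟩
    have hJ := (isConservedCurrent_iff μ J).1 hJ'
    have hcos := isCosymmetry_charFn hJ
    have hV := hcos.dV_eq_zero hμ
    have hx := hcos.D_zero_eq_zero hμ
    have hyz := hcos.laplace_eq_zero hμ
    obtain ⟨χ, hχ, hlift⟩ := exists_coe_eq_lift hV
    refine ⟨χ, (isAdmissible_iff μ hχ hlift).2 ⟨hx, hyz⟩, (characteristic_eq J).trans hlift, ?_⟩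
    rw [← coe_explicitFn μ hlift]
    exact currentEquiv_explicitFn hJ hV hx hyz
  · intro χ hχ
    obtain ⟨ψ, hψ⟩ : ∃ ψ : SmoothCyl Coord, ⇑ψ = lift χ := ⟨.mk _ (isSmooth_lift hχ.1), rfl⟩
    obtain ⟨hx, hyz⟩ := (isAdmissible_iff μ hχ.1 hψ).1 hχ
    rw [← coe_explicitFn μ hψ, isConservedCurrent_iff, characteristic_eq,
      charFn_explicitFn μ (dV_eq_zero_of_coe_eq_lift hψ)]
    exact ⟨totalDiv_explicitFn μ hx hyz, hψ⟩
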